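/- **Setting.** Let $m\ge 1$, let $\mathcal X\subset\mathbb R^d$ be nonempty, closed and convex, let $\xi=(\xi_0,\dots,\xi_m)$ be a random element, and let $F_i(x,\xi_i)$, $i=0,\dots,m$, be continuous and convex in $x\in\mathcal X$, measurable and integrable in $\xi_i$. Put $f_i(x)=\mathbb E[F_i(x,\xi_i)]$, let $r_1,\dots,r_m\in\mathbb R$, and let $f^*$ be the infimum of $f_0(x)$ over $x\in\mathcal X$ with $f_i(x)\le r_i$ ($1\le i\le m$). Assume that there is $\tilde x\in\mathcal X$ with $f_i(\tilde x)<r_i$ for $1\le i\le m$ and $f_0(\tilde x)>f^*$. For $r\in\mathbb R$ put $r_0=r$, $\mathcal P(r,x)=\max_{0\le i\le m}(f_i(x)-r_i)$ and $H(r)=\min_{x\in\mathcal X}\mathcal P(r,x)$. Let $\mathcal Y=\{y\in\mathbb R^{m+1}: y\ge 0,\ \sum_i y_i=1\}$, $\Phi(x,y,\xi)=\sum_{i=0}^m y_i(F_i(x,\xi_i)-r_i)$ and $\phi=\mathbb E\,\Phi$. Let $F_i'(x,\xi_i)\in\partial_x F_i(x,\xi_i)$ be an (integrable, jointly measurable)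 selection of subgradients, $G_x=\sum_i y_iF_i'(x,\xi_i)$, $G_y=(F_i(x,\xi_i)-r_i)_{i=0}^m$ and $G=(G_x,-G_y)$. Let $\|\cdot\|_x,\|\cdot\|_y$ be norms on $\mathbb R^d,\mathbb R^{m+1}$ with dual norms $\|\cdot\|_{*,x},\|\cdot\|_{*,y}$. Let $\omega_x$ on $\mathcal X$ and $\omega_y$ on $\mathcal Y$ be continuous, strongly convex with moduli $\alpha_x,\alpha_y>0$ for these norms, and continuously differentiable on the set of points where they have a subgradient. Suppose that the maxima and minima in $D_x=\sqrt{\max_{\mathcal X}\omega_x-\min_{\mathcal X}\omega_x}$ and $D_y=\sqrt{\max_{\mathcal Y}\omega_y-\min_{\mathcal Y}\omega_y}$ exist. Put $\omega_z(x,y)=\frac{\omega_x(x)}{2D_x^2}+\frac{\omega_y(y)}{2D_y^2}$, $V(z',z)=\omega_z(z)-\omega_z(z')-\nabla\omega_z(z')^\top(z-z')$ and $P_{z'}(\zeta)=\arg\min_{z\in\mathcal X\times\mathcal Y}\{\zeta^\top(z-z')+V(z',z)\}$. Assume that $M_x,M_y,Q>0$ satisfy, for all $x\in\mathcal X$, $y\in\mathcal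 Y$, $$\mathbb E\,e^{\|G_x(x,y,\xi)\|_{*,x}^2/M_x^2}\le e,\qquad \mathbb E\,e^{\|G_y(x,y,\xi)\|_{*,y}^2/M_y^2}\le e,\qquad \mathbb E\,e^{|\Phi(x,y,\xi)-\phi(x,y)|^2/Q^2}\le e .$$ Put $M=\sqrt{\tfrac{2D_x^2}{\alpha_x}M_x^2+\tfrac{2D_y^2}{\alpha_y}M_y^2}$, $\gamma_t=\frac1{M\sqrt{t+1}}$ and $\Omega(\delta)=\max\{\sqrt{12\ln(24/\delta)},\tfrac43\ln(24/\delta)\}$. **Algorithm (OVSMD).** With i.i.d. copies $\xi^{(0)},\xi^{(1)},\dots$ of $\xi$, let $z^{(0)}=(x^{(0)},y^{(0)})\in\arg\min_{\mathcal X\times\mathcal Y}\omega_z$ and $z^{(t+1)}=(x^{(t+1)},y^{(t+1)})=P_{z^{(t)}}(\gamma_tG(x^{(t)},y^{(t)},\xi^{(t)}))$. After the gradient iterations $0,\dots,t$ the algorithm returns $\bar x^{(t)}=\frac{\sum_{s\le t}\gamma_sx^{(s)}}{\sum_{s\le t}\gamma_s}$ and $$\hat u_*^{(t)}=\max_{y\in\mathcal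 Y}\frac1{\sum_{s\le t}\gamma_s}\sum_{s=0}^t\gamma_s\left[\Phi(x^{(s)},y^{(s)},\xi^{(s)})+G_y(x^{(s)},y^{(s)},\xi^{(s)})^\top(y-y^{(s)})\right].$$ **Theorem.** Let $r>f^*$, $\epsilon_{\mathcal A}>0$, $\delta\in(0,1)$, and $$T(\delta,\epsilon_{\mathcal A})=\max\left\{6,\left(\frac{16K}{\epsilon_{\mathcal A}}\ln\frac{8K}{\epsilon_{\mathcal A}}\right)^2-2\right\},\qquad K=Q\,\Omega(\delta)+10M\,\Omega(\delta)+4.5M .$$ In at most $T(\delta,\epsilon_{\mathcal A})$ gradient iterations (that is, for some $t$ with $t+1\le T(\delta,\epsilon_{\mathcal A})$), OVSMD returns an output with $\bar x^{(t)}\in\mathcal X$ such that, with probability at least $1-\delta$, $$\mathcal P(r,\bar x^{(t)})-H(r)\le\epsilon_{\mathcal A}\quad\text{and}\quad|\hat u_*^{(t)}-H(r)|\le\epsilon_{\mathcal A}.$$ Moreover the same holds for every integer $t\ge T(\delta,\epsilon_{\mathcal A})$; thus OVSMD with any iteration limit $T\ge T(\delta,\epsilon_{\mathcal A})$ is a valid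 stochastic oracle: for every $r>f^*$, $\epsilon_{\mathcal A}>0$, $\delta\in(0,1)$ it returns a value $U(r)=\hat u_*^{(t)}$ and a point $\hat x=\bar x^{(t)}\in\mathcal X$ with $\mathcal P(r,\hat x)-H(r)\le\epsilon_{\mathcal A}$ and $|U(r)-H(r)|\le\epsilon_{\mathcal A}$ with probability at least $1-\delta$. -/

import Mathlib

open MeasureTheory ProbabilityTheory

noncomputable section

namespace LevelSet

/-- Euclidean space `ℝⁿ`; `inner ℝ ζ v` is `ζᵀ v`. The norms used by mirror descent are separate
data (see `DistGen`). -/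
abbrev Vec (n : ℕ) := EuclideanSpace ℝ (Fin n)

/-- The dual norm `‖ζ‖_* = sup {ζᵀ v : ‖v‖ ≤ 1}` of a norm `p` on `ℝⁿ`. -/
def dualNorm {n : ℕ} (p : Seminorm ℝ (Vec n)) (ζ : Vec n) : ℝ :=
  sSup ((fun v => inner ℝ ζ v) '' {v | p v ≤ 1})

/-- The subdifferential at `x` of a function `h` with domain `S`. -/
def subdiff {n : ℕ} (S : Set (Vec n)) (h : Vec n → ℝ) (x : Vec n) : Set (Vec n) :=
  {ζ | ∀ z ∈ S, h x + inner ℝ ζ (z - x) ≤ h z}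

/-- A minimizer of `h` over `S`, if there is one. -/
def argminOn {α : Type*} [Nonempty α] (S : Set α) (h : α → ℝ) : α :=
  Classical.epsilon fun z => z ∈ S ∧ IsMinOn h S z

/-- The probability simplex `{y ∈ ℝᵏ : y ≥ 0, ∑ yᵢ = 1}`. -/
def simplex (k : ℕ) : Set (Vec k) := {y | (∀ i, 0 ≤ y i) ∧ ∑ i, y i = 1}

/-- A norm on `ℝⁿ` together with a distance generating function `ω` of modulus `α` for it on `S`:
`ω` is continuous and `α`-strongly convex on `S` and continuously differentiable, with gradient
`grad`, on the set of points of `S` where `ω` has a subgradient. As `S` may have empty interior,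
the gradient is taken relative to `S`. The last two fields say that the maximum and the
minimum in the definition of the diameter of `S` exist. -/
structure DistGen {n : ℕ} (S : Set (Vec n)) where
  nrm : Seminorm ℝ (Vec n)
  nrm_definite : ∀ v, nrm v = 0 → v = 0
  α : ℝ
  α_pos : 0 < α
  ω : Vec n → ℝ
  grad : Vec n → Vec n
  ω_continuousOn : ContinuousOn ω S
  ω_strongConvex : ∀ x ∈ S, ∀ y ∈ S, ∀ a b : ℝ, 0 ≤ a → 0 ≤ b → a + b = 1 →
    ω (a • x + b • y) ≤ a * ω x + b * ω y - α / 2 * a * b * nrm (x - y) ^ 2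
  ω_hasGradient : ∀ x ∈ S, (subdiff S ω x).Nonempty → HasGradientWithinAt ω (grad x) S x
  grad_continuousOn : ContinuousOn grad {x ∈ S | (subdiff S ω x).Nonempty}
  exists_max : ∃ x ∈ S, IsMaxOn ω S x
  exists_min : ∃ x ∈ S, IsMinOn ω S x

/-- The diameter `√(max_S ω - min_S ω)`. -/
def DistGen.diam {n : ℕ} {S : Set (Vec n)} (A : DistGen S) : ℝ :=
  √(sSup (A.ω '' S) - sInf (A.ω '' S))

section Bregman

variable {d k : ℕ} {X : Set (Vec d)} {Y : Set (Vec k)}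

/-- The pairing `ζᵀ z` on `ℝᵈ × ℝᵏ`. -/
def pairing (ζ z : Vec d × Vec k) : ℝ := inner ℝ ζ.1 z.1 + inner ℝ ζ.2 z.2

/-- The distance generating function `ω_x / (2 D_x²) + ω_y / (2 D_y²)` on `X × Y`. -/
def omegaZ (A : DistGen X) (B : DistGen Y) (z : Vec d × Vec k) : ℝ :=
  A.ω z.1 / (2 * A.diam ^ 2) + B.ω z.2 / (2 * B.diam ^ 2)

/-- The gradient of `omegaZ`. -/
def gradZ (A : DistGen X) (B : DistGen Y) (z : Vec d × Vec k) : Vec d × Vec k :=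
  ((2 * A.diam ^ 2)⁻¹ • A.grad z.1, (2 * B.diam ^ 2)⁻¹ • B.grad z.2)

/-- The Bregman divergence `V(z', z)`. -/
def bregman (A : DistGen X) (B : DistGen Y) (z' z : Vec d × Vec k) : ℝ :=
  omegaZ A B z - (omegaZ A B z' + pairing (gradZ A B z') (z - z'))

/-- The prox-mapping `P_{z'}(ζ)`. -/
def prox (A : DistGen X) (B : DistGen Y) (z' ζ : Vec d × Vec k) : Vec d × Vec k :=
  argminOn (X ×ˢ Y) fun z => pairing ζ (z - z') + bregman A B z' z

/-- The constant `M`. -/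
def constM (A : DistGen X) (B : DistGen Y) (Mx My : ℝ) : ℝ :=
  √(2 * A.diam ^ 2 / A.α * Mx ^ 2 + 2 * B.diam ^ 2 / B.α * My ^ 2)

end Bregman

/-- The constant `Ω(δ)`. -/
def constOmega (δ : ℝ) : ℝ :=
  max √(12 * Real.log (24 / δ)) (4 / 3 * Real.log (24 / δ))

/-- The iteration bound `T(δ, ε)`. -/
def iterBound (M Q δ ε : ℝ) : ℝ :=
  max 6
    ((16 * (Q * constOmega δ + 10 * M * constOmega δ + 4.5 * M) / ε *
      Real.log (8 * (Q * constOmega δ + 10 * M * constOmega δ + 4.5 * M) / ε)) ^ 2 - 2)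

/-- The step length `γ_t = 1 / (M √(t + 1))`. -/
def stepLength (M : ℝ) (t : ℕ) : ℝ := 1 / (M * √((t : ℝ) + 1))

universe u

/-- A stochastic optimization problem with expectation constraints:
minimize `E[F₀(x, ξ₀)]` over `x ∈ X` subject to `E[Fᵢ(x, ξᵢ)] ≤ rᵢ`, `i = 1, …, m`, where
`law` is the joint distribution of `ξ = (ξ₀, …, ξₘ)` and `rhs` lists `r₁, …, rₘ`. -/
structure SOEC (d m : ℕ) (Ξ : Fin (m + 1) → Type u) [∀ i, MeasurableSpace (Ξ i)] where
  X : Set (Vec d)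
  X_nonempty : X.Nonempty
  X_closed : IsClosed X
  X_convex : Convex ℝ X
  law : Measure (∀ i, Ξ i)
  law_prob : IsProbabilityMeasure law
  F : ∀ i, Vec d → Ξ i → ℝ
  F_measurable : ∀ i, ∀ x ∈ X, Measurable (F i x)
  F_continuousOn : ∀ i ξ, ContinuousOn (fun x => F i x ξ) X
  F_convexOn : ∀ i ξ, ConvexOn ℝ X (fun x => F i x ξ)
  F_integrable : ∀ i, ∀ x ∈ X, Integrable (fun ξ : ∀ i, Ξ i => F i x (ξ i)) law
  rhs : Fin m → ℝ

namespace SOEC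

variable {d m : ℕ} {Ξ : Fin (m + 1) → Type u} [∀ i, MeasurableSpace (Ξ i)]

/-- `fᵢ(x) = E[Fᵢ(x, ξᵢ)]`. -/
def f (p : SOEC d m Ξ) (i : Fin (m + 1)) (x : Vec d) : ℝ := ∫ ξ, p.F i x (ξ i) ∂p.law

/-- The vector `(r, r₁, …, rₘ)`. -/
def lvl (p : SOEC d m Ξ) (r : ℝ) : Fin (m + 1) → ℝ := Fin.cons r p.rhs

/-- The feasible set. -/
def feasible (p : SOEC d m Ξ) : Set (Vec d) := {x ∈ p.X | ∀ i : Fin m, p.f i.succ x ≤ p.rhs i}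

/-- The optimal value `f^*`. -/
def fstar (p : SOEC d m Ξ) : ℝ := sInf (p.f 0 '' p.feasible)

/-- Strict feasibility: some strictly feasible point is not optimal. -/
def StrictlyFeasible (p : SOEC d m Ξ) : Prop :=
  ∃ x ∈ p.X, (∀ i : Fin m, p.f i.succ x - p.rhs i < 0) ∧ p.fstar < p.f 0 x

/-- `𝒫(r, x) = max {f₀(x) - r, f₁(x) - r₁, …, fₘ(x) - rₘ}`. -/
def P (p : SOEC d m Ξ) (r : ℝ) (x : Vec d) : ℝ :=
  Finset.univ.sup' Finset.univ_nonempty fun i => p.f i x - p.lvl r i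

/-- The level-set function `H(r) = min_{x ∈ X} 𝒫(r, x)`. -/
def H (p : SOEC d m Ξ) (r : ℝ) : ℝ := sInf (p.P r '' p.X)

/-- `Φ(x, y, ξ) = ∑ᵢ yᵢ (Fᵢ(x, ξᵢ) - rᵢ)` with `r₀ = r`. -/
def Phi (p : SOEC d m Ξ) (r : ℝ) (x : Vec d) (y : Vec (m + 1)) (ξ : ∀ i, Ξ i) : ℝ :=
  ∑ i, y i * (p.F i x (ξ i) - p.lvl r i)

/-- `φ(x, y) = E[Φ(x, y, ξ)]`. -/
def phi (p : SOEC d m Ξ) (r : ℝ) (x : Vec d) (y : Vec (m + 1)) : ℝ :=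
  ∫ ξ, p.Phi r x y ξ ∂p.law

/-- `G_x(x, y, ξ) = ∑ᵢ yᵢ F'ᵢ(x, ξᵢ)`. -/
def Gx (_p : SOEC d m Ξ) (F' : ∀ i, Vec d → Ξ i → Vec d)
    (x : Vec d) (y : Vec (m + 1)) (ξ : ∀ i, Ξ i) : Vec d :=
  ∑ i, y i • F' i x (ξ i)

/-- `G_y(x, y, ξ) = (Fᵢ(x, ξᵢ) - rᵢ)ᵢ`, which does not depend on `y`. -/
def Gy (p : SOEC d m Ξ) (r : ℝ) (x : Vec d) (ξ : ∀ i, Ξ i) : Vec (m + 1) :=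
  WithLp.toLp 2 fun i => p.F i x (ξ i) - p.lvl r i

/-- The stochastic subgradient `G = (G_x, -G_y)`. -/
def G (p : SOEC d m Ξ) (F' : ∀ i, Vec d → Ξ i → Vec d) (r : ℝ)
    (z : Vec d × Vec (m + 1)) (ξ : ∀ i, Ξ i) : Vec d × Vec (m + 1) :=
  (p.Gx F' z.1 z.2 ξ, -p.Gy r z.1 ξ)

/-- `F'ᵢ(x, ξᵢ)` is a measurable selection of subgradients of `Fᵢ(·, ξᵢ)` whose expectation
is well defined. -/
structure IsSubgradientSelection (p : SOEC d m Ξ) (F' : ∀ i, Vec d → Ξ i → Vec d) : Prop where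
  measurable : ∀ i, Measurable fun q : p.X × Ξ i => F' i q.1 q.2
  mem_subdiff : ∀ i, ∀ x ∈ p.X, ∀ ξ, F' i x ξ ∈ subdiff p.X (fun x' => p.F i x' ξ) x
  integrable : ∀ i, ∀ x ∈ p.X, Integrable (fun ξ : ∀ i, Ξ i => F' i x (ξ i)) p.law

/-- The light-tail conditions on `G_x`, `G_y` and `Φ`. -/
structure IsLightTailed (p : SOEC d m Ξ) (F' : ∀ i, Vec d → Ξ i → Vec d) (r : ℝ)
    (A : DistGen p.X) (B : DistGen (simplex (m + 1))) (Mx My Q : ℝ) : Prop where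
  gradx : ∀ x ∈ p.X, ∀ y ∈ simplex (m + 1),
    ∫⁻ ξ, ENNReal.ofReal (Real.exp (dualNorm A.nrm (p.Gx F' x y ξ) ^ 2 / Mx ^ 2)) ∂p.law
      ≤ ENNReal.ofReal (Real.exp 1)
  grady : ∀ x ∈ p.X,
    ∫⁻ ξ, ENNReal.ofReal (Real.exp (dualNorm B.nrm (p.Gy r x ξ) ^ 2 / My ^ 2)) ∂p.law
      ≤ ENNReal.ofReal (Real.exp 1)
  obj : ∀ x ∈ p.X, ∀ y ∈ simplex (m + 1),
    ∫⁻ ξ, ENNReal.ofReal (Real.exp (|p.Phi r x y ξ - p.phi r x y| ^ 2 / Q ^ 2)) ∂p.law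
      ≤ ENNReal.ofReal (Real.exp 1)

/-- The iterates `z^(t) = (x^(t), y^(t))` of OVSMD with step lengths `γ` on the sample
sequence `ξ`. -/
def iterate (p : SOEC d m Ξ) (F' : ∀ i, Vec d → Ξ i → Vec d) (r : ℝ)
    (A : DistGen p.X) (B : DistGen (simplex (m + 1))) (γ : ℕ → ℝ) (ξ : ℕ → ∀ i, Ξ i) :
    ℕ → Vec d × Vec (m + 1)
  | 0 => argminOn (p.X ×ˢ simplex (m + 1)) (omegaZ A B)
  | t + 1 =>
    prox A B (iterate p F' r A B γ ξ t) (γ t • p.G F' r (iterate p F' r A B γ ξ t) (ξ t))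

/-- The averaged primal solution `x̄^(t)` that OVSMD returns after the `t + 1` gradient
iterations `0, …, t`. -/
def xbar (p : SOEC d m Ξ) (F' : ∀ i, Vec d → Ξ i → Vec d) (r : ℝ)
    (A : DistGen p.X) (B : DistGen (simplex (m + 1))) (γ : ℕ → ℝ) (ξ : ℕ → ∀ i, Ξ i)
    (t : ℕ) : Vec d :=
  (∑ s ∈ Finset.range (t + 1), γ s)⁻¹ •
    ∑ s ∈ Finset.range (t + 1), γ s • (p.iterate F' r A B γ ξ s).1

/-- The online validation value `û_*^(t)` that OVSMD returns after the `t + 1` gradient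
iterations `0, …, t`. -/
def uhat (p : SOEC d m Ξ) (F' : ∀ i, Vec d → Ξ i → Vec d) (r : ℝ)
    (A : DistGen p.X) (B : DistGen (simplex (m + 1))) (γ : ℕ → ℝ) (ξ : ℕ → ∀ i, Ξ i)
    (t : ℕ) : ℝ :=
  sSup ((fun y : Vec (m + 1) =>
    (∑ s ∈ Finset.range (t + 1), γ s)⁻¹ *
      ∑ s ∈ Finset.range (t + 1), γ s *
        (p.Phi r (p.iterate F' r A B γ ξ s).1 (p.iterate F' r A B γ ξ s).2 (ξ s) +
          inner ℝ (p.Gy r (p.iterate F' r A B γ ξ s).1 (ξ s))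
            (y - (p.iterate F' r A B γ ξ s).2))) '' simplex (m + 1))

/-- The random output `(U, x̂)` meets the requirements of a stochastic oracle `𝒜(r, ε, δ)`. -/
def IsStochasticOracle (p : SOEC d m Ξ) {S : Type*} [MeasurableSpace S] (μ : Measure S)
    (r ε δ : ℝ) (U : S → ℝ) (xhat : S → Vec d) : Prop :=
  (∀ s, xhat s ∈ p.X) ∧
    ENNReal.ofReal (1 - δ) ≤ μ {s | p.P r (xhat s) - p.H r ≤ ε ∧ |U s - p.H r| ≤ ε}

end SOEC

end LevelSet

end

/-! Since `phi` is linear in `y`, its maximum over the simplex is `P r x`, attained at a vertex;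
OVSMD is stochastic mirror descent for this saddle problem, whose min-max value is `H r`. No minimax
theorem is used.

Deterministic part. Fix `z` in `X` with `P r z ≤ H r + ε / 2`. The regret bounds of the two players
(`DistGen.sum_inner_le`, `regret_le`) control the sum of `γ s * (⟨Gx, x_s - z⟩ + ⟨Gy, y - y_s⟩)` for
every `y` in the simplex at once. By convexity the mean of the first pairing is at least `phi(x_s,
y_s) - phi(z, y_s)`, and `phi(z, y_s) ≤ P r z`. Up to noise, this bounds the averaged linear model
at every `y` by `H r + ε / 2`: hence `uhat` from above, and, by Jensen at the vertex where `P r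
xbar` is attained, also `P r xbar`. Conversely `H r ≤ P r xbar`, read at that vertex, bounds `uhat`
from below (`output_le`).

Noise. That vertex depends on the whole sample, so pairing it with the noise `gy - Gy` gives no
martingale. A third mirror-descent sequence `v_s`, driven by the noise itself, repairs this: the
pairing with `y - v_s` is a regret, bounded uniformly in `y` (`aux_regret_le`), and the pairing with
`v_s - y_s` is a martingale difference. The light-tail conditions give sub-Gaussian moment bounds
(`lintegral_exp_mul_le`), and a Chernoff argument over the past (`measure_sum_ge_le`,
`measure_weighted_sum_ge_le`) leaves five bad events, each of probability at most `δ / 24`.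

Rate. The step lengths sum to at least `2 (√(N + 1) - 1) / M` and their squares to at most `(1 + log
N) / M ^ 2`. The resulting error is at most `ε / 2` for `N` of the order of `iterBound` (`rate_le`,
`total_error_le`), the other half being spent on `z`. -/

namespace LevelSet

/-! ### Dual norms. -/

section Norms

variable {n : ℕ} (p : Seminorm ℝ (Vec n))

theorem seminorm_continuous : Continuous p :=
  continuousOn_univ.mp (p.convexOn.continuousOn isOpen_univ)

theorem exists_norm_le_mul_seminorm (hp : ∀ v, p v = 0 → v = 0) :
    ∃ C > 0, ∀ v, ‖v‖ ≤ C * p v := by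
  have hc := seminorm_continuous p
  have hmem : ∀ v : Vec n, v ≠ 0 → ‖v‖⁻¹ • v ∈ Metric.sphere (0 : Vec n) 1 := fun v hv => by
    simp [norm_smul, hv]
  rcases (Metric.sphere (0 : Vec n) 1).eq_empty_or_nonempty with he | hne
  · refine ⟨1, one_pos, fun v => ?_⟩
    by_cases hv : v = 0
    · simp [hv]
    · have := hmem v hv
      simp [he] at this
  · obtain ⟨u, hu, hmin⟩ := (isCompact_sphere (0 : Vec n) 1).exists_isMinOn hne hc.continuousOn
    have hu0 : 0 < p u := (apply_nonneg p u).lt_of_ne' fun h => by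
      have := hp u h
      simp [this] at hu
    refine ⟨(p u)⁻¹, inv_pos.2 hu0, fun v => ?_⟩
    by_cases hv : v = 0
    · simp [hv]
    have hm : p u ≤ p (‖v‖⁻¹ • v) := hmin (hmem v hv)
    have hv' : 0 < ‖v‖ := norm_pos_iff.2 hv
    rw [map_smul_eq_mul, norm_inv, norm_norm] at hm
    field_simp at hm ⊢
    linarith

variable {p}

/-- A real `sSup` of an unbounded set is `0`; equivalence of norms in finite dimension excludes this
case. -/
theorem bddAbove_dualNorm (hp : ∀ v, p v = 0 → v = 0) (ζ : Vec n) :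
    BddAbove ((fun v => inner ℝ ζ v) '' {v | p v ≤ 1}) := by
  obtain ⟨C, hC, h⟩ := exists_norm_le_mul_seminorm p hp
  refine ⟨‖ζ‖ * C, ?_⟩
  rintro _ ⟨v, hv, rfl⟩
  refine (real_inner_le_norm ζ v).trans ?_
  have : ‖v‖ ≤ C := (h v).trans (mul_le_of_le_one_right hC.le hv)
  gcongr

theorem dualNorm_nonneg (hp : ∀ v, p v = 0 → v = 0) (ζ : Vec n) : 0 ≤ dualNorm p ζ :=
  le_csSup (bddAbove_dualNorm hp ζ) ⟨0, by simp, by simp⟩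

theorem inner_le_dualNorm_mul (hp : ∀ v, p v = 0 → v = 0) (ζ v : Vec n) :
    inner ℝ ζ v ≤ dualNorm p ζ * p v := by
  by_cases hv : v = 0
  · simp [hv]
  have hpv : 0 < p v := (apply_nonneg p v).lt_of_ne' fun h => hv (hp v h)
  have h : inner ℝ ζ ((p v)⁻¹ • v) ≤ dualNorm p ζ := by
    refine le_csSup (bddAbove_dualNorm hp ζ) ⟨_, ?_, rfl⟩
    rw [Set.mem_ofPred_eq, map_smul_eq_mul, norm_inv, Real.norm_of_nonneg hpv.le,
      inv_mul_cancel₀ hpv.ne']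
  rw [inner_smul_right, inv_mul_le_iff₀ hpv] at h
  linarith

theorem abs_inner_le_dualNorm_mul (hp : ∀ v, p v = 0 → v = 0) (ζ v : Vec n) :
    |inner ℝ ζ v| ≤ dualNorm p ζ * p v := by
  refine abs_le.2 ⟨?_, inner_le_dualNorm_mul hp ζ v⟩
  have := inner_le_dualNorm_mul hp ζ (-v)
  rw [inner_neg_right, map_neg_eq_map] at this
  linarith

theorem dualNorm_le {c : ℝ} (hc : 0 ≤ c) {ζ : Vec n} (h : ∀ v, inner ℝ ζ v ≤ c * p v) :
    dualNorm p ζ ≤ c := by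
  refine csSup_le ⟨_, 0, by simp, rfl⟩ ?_
  rintro _ ⟨v, hv, rfl⟩
  exact (h v).trans (mul_le_of_le_one_right hc hv)

theorem dualNorm_add_le (hp : ∀ v, p v = 0 → v = 0) (ζ η : Vec n) :
    dualNorm p (ζ + η) ≤ dualNorm p ζ + dualNorm p η :=
  dualNorm_le (add_nonneg (dualNorm_nonneg hp _) (dualNorm_nonneg hp _)) fun v => by
    rw [inner_add_left, add_mul]
    exact add_le_add (inner_le_dualNorm_mul hp ζ v) (inner_le_dualNorm_mul hp η v)

theorem dualNorm_neg (hp : ∀ v, p v = 0 → v = 0) (ζ : Vec n) :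
    dualNorm p (-ζ) = dualNorm p ζ := by
  have h : ∀ ζ : Vec n, dualNorm p (-ζ) ≤ dualNorm p ζ := fun ζ =>
    dualNorm_le (dualNorm_nonneg hp _) fun v => by
      rw [inner_neg_left]
      exact (neg_le_abs _).trans (abs_inner_le_dualNorm_mul hp ζ v)
  exact (h ζ).antisymm (by simpa using h (-ζ))

theorem dualNorm_smul_le (hp : ∀ v, p v = 0 → v = 0) {a : ℝ} (ha : 0 ≤ a) (ζ : Vec n) :
    dualNorm p (a • ζ) ≤ a * dualNorm p ζ :=
  dualNorm_le (mul_nonneg ha (dualNorm_nonneg hp _)) fun v => by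
    rw [real_inner_smul_left, mul_assoc]
    exact mul_le_mul_of_nonneg_left (inner_le_dualNorm_mul hp ζ v) ha

theorem dualNorm_continuous (hp : ∀ v, p v = 0 → v = 0) : Continuous (dualNorm p) := by
  obtain ⟨C, hC, h⟩ := exists_norm_le_mul_seminorm p hp
  have hb : ∀ ζ : Vec n, dualNorm p ζ ≤ C * ‖ζ‖ := fun ζ =>
    dualNorm_le (by positivity) fun v => (real_inner_le_norm ζ v).trans (by
      nlinarith [h v, norm_nonneg ζ, norm_nonneg v])
  refine (LipschitzWith.of_le_add_mul C.toNNReal fun x y => ?_).continuous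
  have h1 := dualNorm_add_le hp y (x - y)
  rw [add_sub_cancel] at h1
  rw [Real.coe_toNNReal _ hC.le, dist_eq_norm]
  linarith [hb (x - y)]

theorem sq_dualNorm_sub_le (hp : ∀ v, p v = 0 → v = 0) (ζ η : Vec n) :
    dualNorm p (ζ - η) ^ 2 ≤ 2 * dualNorm p ζ ^ 2 + 2 * dualNorm p η ^ 2 := by
  have h := dualNorm_add_le hp ζ (-η)
  rw [← sub_eq_add_neg, dualNorm_neg hp] at h
  have h0 := dualNorm_nonneg hp (ζ - η)
  nlinarith [sq_nonneg (dualNorm p ζ - dualNorm p η)]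

end Norms

theorem le_of_forall_one_sub_mul_le {u w : ℝ}
    (h : ∀ b, 0 < b → b < 1 → (1 - b) * u ≤ w) : u ≤ w := by
  by_contra! hlt
  have hw : 0 ≤ w := by linarith [h (1 / 2) (by norm_num) (by norm_num)]
  have hu' : 0 < u := by linarith
  have h1 := h ((u - w) / (2 * u)) (div_pos (by linarith) (by linarith))
    ((div_lt_one (by linarith)).2 (by linarith))
  have h2 : (u - w) / (2 * u) * u = (u - w) / 2 := by field_simp
  nlinarith

theorem argminOn_spec {α : Type*} [Nonempty α] {S : Set α} {h : α → ℝ}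
    (hx : ∃ x ∈ S, IsMinOn h S x) : argminOn S h ∈ S ∧ IsMinOn h S (argminOn S h) :=
  Classical.epsilon_spec (p := fun z => z ∈ S ∧ IsMinOn h S z) hx

/-! ### Mirror descent for one distance generating function. -/

namespace DistGen

variable {n : ℕ} {S : Set (Vec n)} (A : DistGen S)

/-- The set of points of `S` where `ω` has a subgradient. -/
def dom : Set (Vec n) := {x ∈ S | (subdiff S A.ω x).Nonempty}

/-- The factor `1 / (2 D²)` by which `ω` is normalized. -/
noncomputable def scale : ℝ := (2 * A.diam ^ 2)⁻¹

/-- The ratio `2 D² / α`. -/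
noncomputable def ratio : ℝ := 2 * A.diam ^ 2 / A.α

/-- The minimizer of `⟪η, z⟫ + ω z / (2 D²)` over `S`. -/
noncomputable def mirror (η : Vec n) : Vec n := argminOn S fun z => inner ℝ η z + A.scale * A.ω z

/-- The prox-mapping of the normalized distance generating function. -/
noncomputable def step (x ζ : Vec n) : Vec n := A.mirror (ζ - A.scale • A.grad x)

/-- The Bregman divergence of `ω`. -/
noncomputable def div (x z : Vec n) : ℝ := A.ω z - A.ω x - inner ℝ (A.grad x) (z - x)

theorem sub_le_diam_sq {x y : Vec n} (hx : x ∈ S) (hy : y ∈ S) :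
    A.ω x - A.ω y ≤ A.diam ^ 2 := by
  obtain ⟨M, hM, hmax⟩ := A.exists_max
  obtain ⟨m, hm, hmin⟩ := A.exists_min
  have h1 : A.ω x ≤ sSup (A.ω '' S) :=
    le_csSup ⟨A.ω M, by rintro _ ⟨z, hz, rfl⟩; exact hmax hz⟩ ⟨x, hx, rfl⟩
  have h2 : sInf (A.ω '' S) ≤ A.ω y :=
    csInf_le ⟨A.ω m, by rintro _ ⟨z, hz, rfl⟩; exact hmin hz⟩ ⟨y, hy, rfl⟩
  unfold diam
  by_cases h : 0 ≤ sSup (A.ω '' S) - sInf (A.ω '' S)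
  · rw [Real.sq_sqrt h]; linarith
  · have h3 : A.ω m ≤ sSup (A.ω '' S) :=
      le_csSup ⟨A.ω M, by rintro _ ⟨z, hz, rfl⟩; exact hmax hz⟩ ⟨m, hm, rfl⟩
    have h4 : sInf (A.ω '' S) ≤ A.ω m :=
      csInf_le ⟨A.ω m, by rintro _ ⟨z, hz, rfl⟩; exact hmin hz⟩ ⟨m, hm, rfl⟩
    linarith

variable {A}

/-- Strong convexity at the midpoint: `ω` drops there by `α / 8` times the squared distance below
the average of the end values, and a drop is at most `diam ^ 2`. -/
theorem sq_nrm_sub_le (hS : Convex ℝ S) {x y : Vec n} (hx : x ∈ S) (hy : y ∈ S) :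
    A.nrm (x - y) ^ 2 ≤ 4 * A.ratio := by
  have hmid : (1 / 2 : ℝ) • x + (1 / 2 : ℝ) • y ∈ S :=
    hS hx hy (by norm_num) (by norm_num) (by norm_num)
  have h := A.ω_strongConvex x hx y hy (1 / 2) (1 / 2) (by norm_num) (by norm_num) (by norm_num)
  have h1 := A.sub_le_diam_sq hx hmid
  have h2 := A.sub_le_diam_sq hy hmid
  have := A.α_pos
  unfold ratio
  rw [mul_div_assoc', le_div_iff₀ this]
  nlinarith

theorem diam_pos (hS : Convex ℝ S) (hnt : S.Nontrivial) : 0 < A.diam := by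
  obtain ⟨x, hx, y, hy, hxy⟩ := hnt
  refine (Real.sqrt_nonneg _).lt_of_ne' fun h => ?_
  have h1 := sq_nrm_sub_le (A := A) hS hx hy
  have h0 : A.nrm (x - y) ≠ 0 := fun h => hxy (sub_eq_zero.1 (A.nrm_definite _ h))
  have : 0 < A.nrm (x - y) ^ 2 := by positivity
  have h' : A.diam = 0 := h
  rw [ratio, h'] at h1
  norm_num at h1
  exact h0 h1

theorem isCompact (A : DistGen S) (hS : Convex ℝ S) (hc : IsClosed S) : IsCompact S := by
  obtain ⟨C, hC, h⟩ := exists_norm_le_mul_seminorm A.nrm A.nrm_definite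
  refine Metric.isCompact_of_isClosed_isBounded hc ?_
  rw [Metric.isBounded_iff]
  refine ⟨C * √(4 * A.ratio), fun x hx y hy => ?_⟩
  rw [dist_eq_norm]
  refine (h _).trans (mul_le_mul_of_nonneg_left ?_ hC.le)
  exact Real.le_sqrt_of_sq_le (sq_nrm_sub_le hS hx hy)

theorem scale_pos (hD : 0 < A.diam) : 0 < A.scale := by
  unfold scale; positivity

theorem ratio_pos (hD : 0 < A.diam) : 0 < A.ratio :=
  div_pos (by positivity) A.α_pos

theorem scale_mul_alpha_mul_ratio (hD : 0 < A.diam) : A.scale * A.α * A.ratio = 1 := by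
  have := A.α_pos
  unfold scale ratio
  field_simp

/-- Compare `x` with the point `b z + (1 - b) x`, divide by `b` and let `b` tend to `0`. -/
theorem quadratic_growth (hS : Convex ℝ S) {c : ℝ} (hc : 0 ≤ c) {η x z : Vec n} (hx : x ∈ S)
    (hz : z ∈ S) (hmin : IsMinOn (fun z => inner ℝ η z + c * A.ω z) S x) :
    inner ℝ η x + c * A.ω x + c * A.α / 2 * A.nrm (z - x) ^ 2 ≤ inner ℝ η z + c * A.ω z := by
  have hα := A.α_pos
  have key : c * A.α / 2 * A.nrm (z - x) ^ 2
      ≤ inner ℝ η z + c * A.ω z - (inner ℝ η x + c * A.ω x) := by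
    refine le_of_forall_one_sub_mul_le fun b hb hb1 => ?_
    have h1 := A.ω_strongConvex z hz x hx b (1 - b) hb.le (by linarith) (by ring)
    have h2 : inner ℝ η x + c * A.ω x ≤
        inner ℝ η (b • z + (1 - b) • x) + c * A.ω (b • z + (1 - b) • x) :=
      hmin (hS hz hx hb.le (by linarith) (by ring))
    rw [inner_add_right, inner_smul_right, inner_smul_right] at h2
    have h3 := mul_le_mul_of_nonneg_left h1 hc
    have h4 : b * ((1 - b) * (c * A.α / 2 * A.nrm (z - x) ^ 2)) ≤
        b * (inner ℝ η z + c * A.ω z - (inner ℝ η x + c * A.ω x)) := by linarith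
    exact le_of_mul_le_mul_left h4 hb
  linarith

theorem isMinOn_unique (hS : Convex ℝ S) {c : ℝ} (hc : 0 < c) {η x z : Vec n} (hx : x ∈ S)
    (hz : z ∈ S) (hmin : IsMinOn (fun z => inner ℝ η z + c * A.ω z) S x)
    (hmin' : IsMinOn (fun z => inner ℝ η z + c * A.ω z) S z) : z = x := by
  have h1 := quadratic_growth hS hc.le hx hz hmin
  have h2 : inner ℝ η z + c * A.ω z ≤ inner ℝ η x + c * A.ω x := hmin' hx
  have hα := A.α_pos
  by_contra hne
  have h0 : A.nrm (z - x) ≠ 0 := fun h => hne (sub_eq_zero.1 (A.nrm_definite _ h))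
  have : 0 < c * A.α / 2 * A.nrm (z - x) ^ 2 := by positivity
  linarith

theorem mirror_spec (hS : Convex ℝ S) (hcl : IsClosed S) (η : Vec n) :
    A.mirror η ∈ S ∧ IsMinOn (fun z => inner ℝ η z + A.scale * A.ω z) S (A.mirror η) := by
  refine argminOn_spec ?_
  have hne : S.Nonempty := A.exists_max.imp fun _ h => h.1
  have hcont : ContinuousOn (fun z => inner ℝ η z + A.scale * A.ω z) S :=
    (continuous_const.inner continuous_id).continuousOn.add
      (continuousOn_const.mul A.ω_continuousOn)
  exact (isCompact A hS hcl).exists_isMinOn hne hcont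

theorem mirror_mem_dom (hS : Convex ℝ S) (hcl : IsClosed S) (hD : 0 < A.diam) (η : Vec n) :
    A.mirror η ∈ A.dom := by
  obtain ⟨hm, hmin⟩ := mirror_spec (A := A) hS hcl η
  have hc := scale_pos hD
  refine ⟨hm, -(A.scale⁻¹ • η), fun z hz => ?_⟩
  have h : inner ℝ η (A.mirror η) + A.scale * A.ω (A.mirror η) ≤ inner ℝ η z + A.scale * A.ω z :=
    hmin hz
  rw [inner_neg_left, real_inner_smul_left, inner_sub_right]
  refine le_of_mul_le_mul_left ?_ hc
  have : A.scale * (A.ω (A.mirror η) + -(A.scale⁻¹ * (inner ℝ η z - inner ℝ η (A.mirror η))))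
      = A.scale * A.ω (A.mirror η) - (inner ℝ η z - inner ℝ η (A.mirror η)) := by
    field_simp
    ring
  linarith

/-- Adding the quadratic growth at the two minimizers makes the map Lipschitz. This is what makes
iterates defined by a choice of minimizer measurable in the sample. -/
theorem mirror_continuous (hS : Convex ℝ S) (hcl : IsClosed S) (hD : 0 < A.diam) :
    Continuous A.mirror := by
  obtain ⟨C, hC, h⟩ := exists_norm_le_mul_seminorm A.nrm A.nrm_definite
  have hc := scale_pos hD
  have hα := A.α_pos
  have hca : 0 < A.scale * A.α := by positivity
  refine (LipschitzWith.of_dist_le_mul (K := (C ^ 2 / (A.scale * A.α)).toNNReal)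
    fun η₁ η₂ => ?_).continuous
  rw [Real.coe_toNNReal _ (by positivity), dist_eq_norm, dist_eq_norm]
  obtain ⟨hm₁, hmin₁⟩ := mirror_spec (A := A) hS hcl η₁
  obtain ⟨hm₂, hmin₂⟩ := mirror_spec (A := A) hS hcl η₂
  set x₁ := A.mirror η₁
  set x₂ := A.mirror η₂
  have h1 := quadratic_growth hS hc.le hm₁ hm₂ hmin₁
  have h2 := quadratic_growth hS hc.le hm₂ hm₁ hmin₂
  rw [map_sub_rev] at h1
  have h3 : A.scale * A.α * A.nrm (x₁ - x₂) ^ 2 ≤ ‖η₁ - η₂‖ * ‖x₁ - x₂‖ := by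
    have := real_inner_le_norm (η₁ - η₂) (x₂ - x₁)
    rw [norm_sub_rev x₂ x₁, inner_sub_right, inner_sub_left, inner_sub_left] at this
    linarith
  have h4 : ‖x₁ - x₂‖ ^ 2 ≤ C ^ 2 * A.nrm (x₁ - x₂) ^ 2 := by
    rw [← mul_pow]
    exact pow_le_pow_left₀ (norm_nonneg _) (h _) 2
  rw [div_mul_eq_mul_div, le_div_iff₀ hca]
  rcases (norm_nonneg (x₁ - x₂)).eq_or_lt with h0 | h0
  · rw [← h0]; simp; positivity
  refine le_of_mul_le_mul_right ?_ h0
  nlinarith [mul_le_mul_of_nonneg_left h3 (sq_nonneg C), mul_le_mul_of_nonneg_left h4 hca.le]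

/-- The gradient is only relative to `S`, so derivatives are taken along segments that stay in `S`.
-/
theorem tendsto_slope (hS : Convex ℝ S) {x z : Vec n} (hx : x ∈ A.dom) (hz : z ∈ S) :
    Filter.Tendsto (fun t : ℝ => t⁻¹ * (A.ω (x + t • (z - x)) - A.ω x))
      (nhdsWithin 0 (Set.Ioo 0 1)) (nhds (inner ℝ (A.grad x) (z - x))) := by
  have hg := (A.ω_hasGradient x hx.1 hx.2).hasFDerivWithinAt
  have hl : HasDerivWithinAt (fun t : ℝ => x + t • (z - x)) (z - x) (Set.Ioo 0 1) 0 := by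
    have := ((hasDerivAt_id (0 : ℝ)).smul_const (z - x)).const_add x
    simpa using this.hasDerivWithinAt
  have hmaps : Set.MapsTo (fun t : ℝ => x + t • (z - x)) (Set.Ioo 0 1) S := fun t ht =>
    hS.add_smul_sub_mem hx.1 hz ⟨ht.1.le, ht.2.le⟩
  have hg' : HasFDerivWithinAt A.ω ((InnerProductSpace.toDual ℝ (Vec n)) (A.grad x)) S
      ((fun t : ℝ => x + t • (z - x)) 0) := by simpa using hg
  have h := hg'.comp_hasDerivWithinAt 0 hl hmaps
  rw [hasDerivWithinAt_iff_tendsto_slope' (by simp)] at h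
  refine h.congr fun t => ?_
  simp [slope]

theorem grad_lower_bound (hS : Convex ℝ S) {x z : Vec n} (hx : x ∈ A.dom) (hz : z ∈ S) :
    A.α / 2 * A.nrm (z - x) ^ 2 ≤ A.div x z := by
  have hne : (nhdsWithin (0 : ℝ) (Set.Ioo 0 1)).NeBot := by
    rw [← mem_closure_iff_nhdsWithin_neBot, closure_Ioo zero_ne_one]; simp
  have h1 := tendsto_slope hS hx hz
  have h2 : Filter.Tendsto
      (fun t : ℝ => A.ω z - A.ω x - A.α / 2 * (1 - t) * A.nrm (z - x) ^ 2)
      (nhdsWithin 0 (Set.Ioo 0 1)) (nhds (A.ω z - A.ω x - A.α / 2 * A.nrm (z - x) ^ 2)) := by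
    have : Continuous fun t : ℝ => A.ω z - A.ω x - A.α / 2 * (1 - t) * A.nrm (z - x) ^ 2 := by
      fun_prop
    simpa using (this.tendsto 0).mono_left (nhdsWithin_le_nhds (s := Set.Ioo 0 1))
  have h3 := le_of_tendsto_of_tendsto h1 h2 (by
    filter_upwards [self_mem_nhdsWithin] with t ht
    rw [inv_mul_le_iff₀ ht.1]
    have := A.ω_strongConvex z hz x hx.1 t (1 - t) ht.1.le (by linarith [ht.2]) (by ring)
    have he : x + t • (z - x) = t • z + (1 - t) • x := by module
    rw [he]
    linarith)
  unfold div
  linarith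

theorem div_nonneg (hS : Convex ℝ S) {x z : Vec n} (hx : x ∈ A.dom) (hz : z ∈ S) :
    0 ≤ A.div x z := by
  have := A.α_pos
  exact le_trans (by positivity) (grad_lower_bound hS hx hz)

theorem mirror_optimality (hS : Convex ℝ S) (hcl : IsClosed S) (hD : 0 < A.diam) (η : Vec n)
    {z : Vec n} (hz : z ∈ S) :
    0 ≤ inner ℝ (η + A.scale • A.grad (A.mirror η)) (z - A.mirror η) := by
  have hne : (nhdsWithin (0 : ℝ) (Set.Ioo 0 1)).NeBot := by
    rw [← mem_closure_iff_nhdsWithin_neBot, closure_Ioo zero_ne_one]; simp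
  obtain ⟨hm, hmin⟩ := mirror_spec (A := A) hS hcl η
  have hdom := mirror_mem_dom (A := A) hS hcl hD η
  set x := A.mirror η
  have h1 := ((tendsto_slope hS hdom hz).const_mul A.scale).const_add (inner ℝ η (z - x))
  rw [inner_add_left, real_inner_smul_left]
  refine ge_of_tendsto h1 ?_
  filter_upwards [self_mem_nhdsWithin] with t ht
  have h2 : inner ℝ η x + A.scale * A.ω x ≤
      inner ℝ η (x + t • (z - x)) + A.scale * A.ω (x + t • (z - x)) :=
    hmin (hS.add_smul_sub_mem hm hz ⟨ht.1.le, ht.2.le⟩)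
  rw [inner_add_right, inner_smul_right] at h2
  have ht0 := ht.1
  have h3 : 0 ≤ t⁻¹ * (t * inner ℝ η (z - x) + A.scale * (A.ω (x + t • (z - x)) - A.ω x)) :=
    mul_nonneg (inv_nonneg.2 ht0.le) (by linarith)
  have h4 : t⁻¹ * (t * inner ℝ η (z - x) + A.scale * (A.ω (x + t • (z - x)) - A.ω x)) =
      inner ℝ η (z - x) + A.scale * (t⁻¹ * (A.ω (x + t • (z - x)) - A.ω x)) := by
    field_simp
  linarith

theorem step_mem_dom (hS : Convex ℝ S) (hcl : IsClosed S) (hD : 0 < A.diam) (x ζ : Vec n) :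
    A.step x ζ ∈ A.dom := mirror_mem_dom hS hcl hD _

/-- The three-point identity rewrites the optimality of the new point `x'` as a difference of
divergences minus `scale * div x x'`. That last term is at least quadratic in `x - x'` and absorbs
`⟨ζ, x - x'⟩` by Young's inequality, because `scale * α * ratio = 1`. -/
theorem inner_step_le (hS : Convex ℝ S) (hcl : IsClosed S) (hD : 0 < A.diam) {x z : Vec n}
    (hx : x ∈ A.dom) (ζ : Vec n) (hz : z ∈ S) :
    inner ℝ ζ (x - z) ≤ A.scale * A.div x z - A.scale * A.div (A.step x ζ) z
      + A.ratio / 2 * dualNorm A.nrm ζ ^ 2 := by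
  have hdom := step_mem_dom (A := A) hS hcl hD x ζ
  have hopt := mirror_optimality (A := A) hS hcl hD (ζ - A.scale • A.grad x) hz
  change 0 ≤ inner ℝ (ζ - A.scale • A.grad x + A.scale • A.grad (A.step x ζ))
    (z - A.step x ζ) at hopt
  set x' := A.step x ζ
  have hlow := mul_le_mul_of_nonneg_left (grad_lower_bound hS hx hdom.1) (scale_pos hD).le
  have hdual := inner_le_dualNorm_mul A.nrm_definite ζ (x - x')
  rw [map_sub_rev] at hlow
  have hr := scale_mul_alpha_mul_ratio hD
  have hrpos := ratio_pos hD
  have hyoung : dualNorm A.nrm ζ * A.nrm (x - x') ≤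
      A.ratio / 2 * dualNorm A.nrm ζ ^ 2 + A.scale * (A.α / 2 * A.nrm (x - x') ^ 2) := by
    have hca : A.scale * A.α = 1 / A.ratio := by field_simp; linarith
    have : A.scale * (A.α / 2 * A.nrm (x - x') ^ 2) = A.nrm (x - x') ^ 2 / (2 * A.ratio) := by
      rw [show A.scale * (A.α / 2 * A.nrm (x - x') ^ 2)
        = A.scale * A.α / 2 * A.nrm (x - x') ^ 2 by ring, hca]
      field_simp
    rw [this]
    have h0 := sq_nonneg (A.ratio * dualNorm A.nrm ζ - A.nrm (x - x'))
    have : A.ratio / 2 * dualNorm A.nrm ζ ^ 2 + A.nrm (x - x') ^ 2 / (2 * A.ratio)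
        - dualNorm A.nrm ζ * A.nrm (x - x')
        = (A.ratio * dualNorm A.nrm ζ - A.nrm (x - x')) ^ 2 / (2 * A.ratio) := by
      field_simp; ring
    have : 0 ≤ (A.ratio * dualNorm A.nrm ζ - A.nrm (x - x')) ^ 2 / (2 * A.ratio) := by positivity
    linarith
  simp only [div, inner_add_left, inner_sub_left, inner_sub_right, real_inner_smul_left]
    at hopt hlow hdual ⊢
  linarith

/-- At the minimizer of `ω` the linear term of the divergence has a favourable sign, so only the
oscillation `diam ^ 2` remains; the normalization turns it into `1 / 2`. -/
theorem div_mirror_zero_le (hS : Convex ℝ S) (hcl : IsClosed S) (hD : 0 < A.diam) {z : Vec n}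
    (hz : z ∈ S) : A.scale * A.div (A.mirror 0) z ≤ 1 / 2 := by
  have hopt := mirror_optimality (A := A) hS hcl hD 0 hz
  have hm := (mirror_spec (A := A) hS hcl 0).1
  rw [zero_add, real_inner_smul_left] at hopt
  have h := mul_le_mul_of_nonneg_left (A.sub_le_diam_sq hz hm) (scale_pos hD).le
  have h1 : A.scale * A.diam ^ 2 = 1 / 2 := by
    unfold scale; field_simp
  unfold div
  linarith

/-- The regret bound of mirror descent. -/
theorem sum_inner_le (hS : Convex ℝ S) (hcl : IsClosed S) (hD : 0 < A.diam) {x ζ : ℕ → Vec n}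
    (h0 : x 0 = A.mirror 0) (hstep : ∀ t, x (t + 1) = A.step (x t) (ζ t)) {z : Vec n}
    (hz : z ∈ S) (N : ℕ) :
    ∑ s ∈ Finset.range N, inner ℝ (ζ s) (x s - z) ≤
      1 / 2 + A.ratio / 2 * ∑ s ∈ Finset.range N, dualNorm A.nrm (ζ s) ^ 2 := by
  have hdom : ∀ t, x t ∈ A.dom := fun t => by
    cases t with
    | zero => rw [h0]; exact mirror_mem_dom hS hcl hD 0
    | succ t => rw [hstep]; exact step_mem_dom hS hcl hD _ _
  have key : ∑ s ∈ Finset.range N, inner ℝ (ζ s) (x s - z) ≤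
      A.scale * A.div (x 0) z - A.scale * A.div (x N) z
        + A.ratio / 2 * ∑ s ∈ Finset.range N, dualNorm A.nrm (ζ s) ^ 2 := by
    induction N with
    | zero => simp
    | succ N ih =>
      rw [Finset.sum_range_succ, Finset.sum_range_succ, hstep]
      have := inner_step_le hS hcl hD (hdom N) (ζ N) hz
      linarith
  have h1 := mul_nonneg (scale_pos hD).le (div_nonneg hS (hdom N) hz)
  have h2 := div_mirror_zero_le (A := A) hS hcl hD hz
  rw [h0] at key
  linarith

end DistGen

/-! ### The prox-mapping on the product splits into the two factors. -/

section Product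

variable {d k : ℕ} {X : Set (Vec d)} {Y : Set (Vec k)} {A : DistGen X} {B : DistGen Y}

/-- A separable objective is minimized coordinatewise; strict convexity makes the minimizer unique,
so the two choices agree. -/
theorem argminOn_prod (hX : Convex ℝ X) (hXc : IsClosed X) (hA : 0 < A.diam)
    (hY : Convex ℝ Y) (hYc : IsClosed Y) (hB : 0 < B.diam) {η : Vec d} {θ : Vec k}
    {h : Vec d × Vec k → ℝ} {c : ℝ}
    (hh : ∀ z, h z = inner ℝ η z.1 + A.scale * A.ω z.1 +
      (inner ℝ θ z.2 + B.scale * B.ω z.2) + c) :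
    argminOn (X ×ˢ Y) h = (A.mirror η, B.mirror θ) := by
  obtain ⟨hx, hxmin⟩ := DistGen.mirror_spec (A := A) hX hXc η
  obtain ⟨hy, hymin⟩ := DistGen.mirror_spec (A := B) hY hYc θ
  have hex : ∃ z ∈ X ×ˢ Y, IsMinOn h (X ×ˢ Y) z := by
    refine ⟨(A.mirror η, B.mirror θ), ⟨hx, hy⟩, fun z hz => ?_⟩
    have h1 := hxmin hz.1
    have h2 := hymin hz.2
    simp only [Set.mem_ofPred_eq] at h1 h2 ⊢
    rw [hh, hh]
    linarith
  obtain ⟨hm, hmin⟩ := argminOn_spec hex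
  set w := argminOn (X ×ˢ Y) h
  refine Prod.ext ?_ ?_
  · refine DistGen.isMinOn_unique hX (DistGen.scale_pos hA) hx hm.1 hxmin fun z hz => ?_
    have := hmin (show (z, w.2) ∈ X ×ˢ Y from ⟨hz, hm.2⟩)
    simp only [Set.mem_ofPred_eq] at this ⊢
    rw [hh, hh] at this
    linarith
  · refine DistGen.isMinOn_unique hY (DistGen.scale_pos hB) hy hm.2 hymin fun z hz => ?_
    have := hmin (show (w.1, z) ∈ X ×ˢ Y from ⟨hm.1, hz⟩)
    simp only [Set.mem_ofPred_eq] at this ⊢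
    rw [hh, hh] at this
    linarith

theorem prox_eq (hX : Convex ℝ X) (hXc : IsClosed X) (hA : 0 < A.diam)
    (hY : Convex ℝ Y) (hYc : IsClosed Y) (hB : 0 < B.diam) (z ζ : Vec d × Vec k) :
    prox A B z ζ = (A.step z.1 ζ.1, B.step z.2 ζ.2) := by
  refine argminOn_prod hX hXc hA hY hYc hB (c := - pairing ζ z - omegaZ A B z
    + pairing (gradZ A B z) z) fun w => ?_
  simp only [bregman, pairing, omegaZ, gradZ, Prod.fst_sub, Prod.snd_sub, inner_sub_left,
    inner_sub_right, real_inner_smul_left, DistGen.scale, div_eq_inv_mul]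
  ring

theorem argminOn_omegaZ (hX : Convex ℝ X) (hXc : IsClosed X) (hA : 0 < A.diam)
    (hY : Convex ℝ Y) (hYc : IsClosed Y) (hB : 0 < B.diam) :
    argminOn (X ×ˢ Y) (omegaZ A B) = (A.mirror 0, B.mirror 0) :=
  argminOn_prod hX hXc hA hY hYc hB (c := 0) fun w => by
    simp only [omegaZ, inner_zero_left, DistGen.scale, div_eq_inv_mul]
    ring

end Product

end LevelSet

namespace LevelSet

/-! ### Moment generating functions under light tails. -/

section Scalar

variable {E : Type*} [MeasurableSpace E] {ν : Measure E}

theorem exp_le_add_exp_sq (x : ℝ) : Real.exp x ≤ x + Real.exp (x ^ 2) := by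
  have h2 := Real.add_one_le_exp (x ^ 2)
  rcases le_total |x| 1 with h | h
  · have := (abs_le.1 (Real.abs_exp_sub_one_sub_id_le h)).2
    linarith
  · rcases le_abs'.1 h with h | h
    · have : Real.exp x ≤ 1 := Real.exp_le_one_iff.2 (by linarith)
      nlinarith
    · have : Real.exp x ≤ Real.exp (x ^ 2) := Real.exp_le_exp.2 (by nlinarith)
      linarith

theorem integrable_exp_of_lintegral_le {g : E → ℝ} {c : ℝ} (hg : Measurable g)
    (h : ∫⁻ e, ENNReal.ofReal (Real.exp (g e)) ∂ν ≤ ENNReal.ofReal c) :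
    Integrable (fun e => Real.exp (g e)) ν := by
  refine ⟨hg.exp.aestronglyMeasurable, ?_⟩
  rw [hasFiniteIntegral_iff_ofReal (Filter.Eventually.of_forall fun e => (Real.exp_pos _).le)]
  exact h.trans_lt ENNReal.ofReal_lt_top

theorem integral_exp_le {g : E → ℝ} {c : ℝ} (hc : 0 ≤ c) (hg : Measurable g)
    (h : ∫⁻ e, ENNReal.ofReal (Real.exp (g e)) ∂ν ≤ ENNReal.ofReal c) :
    ∫ e, Real.exp (g e) ∂ν ≤ c := by
  rw [← ofReal_integral_eq_lintegral_ofReal (integrable_exp_of_lintegral_le hg h)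
    (Filter.Eventually.of_forall fun e => (Real.exp_pos _).le)] at h
  exact (ENNReal.ofReal_le_ofReal_iff hc).1 h

theorem lintegral_exp_le_of_le {g h : E → ℝ} {c : ℝ} (hgh : ∀ e, Real.exp (g e) ≤ h e)
    (hi : Integrable h ν) (hc : ∫ e, h e ∂ν ≤ c) :
    ∫⁻ e, ENNReal.ofReal (Real.exp (g e)) ∂ν ≤ ENNReal.ofReal c := by
  refine (lintegral_mono fun e => ENNReal.ofReal_le_ofReal (hgh e)).trans ?_
  rw [← ofReal_integral_eq_lintegral_ofReal hi
    (Filter.Eventually.of_forall fun e => (Real.exp_pos _).le.trans (hgh e))]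
  exact ENNReal.ofReal_le_ofReal hc

theorem exp_mul_le {a w : ℝ} (ha : 0 ≤ a) (ha1 : a ≤ 1) :
    Real.exp (a * w) ≤ a * Real.exp w + (1 - a) := by
  have := convexOn_exp.2 (Set.mem_univ w) (Set.mem_univ 0) ha (sub_nonneg.2 ha1) (by ring)
  simpa using this

theorem integrable_of_lintegral_exp_sq {d : E → ℝ} {σ : ℝ} (hd : Measurable d) (hσ : 0 < σ)
    (h : ∫⁻ e, ENNReal.ofReal (Real.exp (d e ^ 2 / σ ^ 2)) ∂ν ≤ ENNReal.ofReal (Real.exp 1)) :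
    Integrable d ν := by
  have hi := integrable_exp_of_lintegral_le ((hd.pow_const 2).div_const _) h
  refine (hi.const_mul σ).mono' hd.aestronglyMeasurable (Filter.Eventually.of_forall fun e => ?_)
  rw [Real.norm_eq_abs]
  have h1 := Real.add_one_le_exp (d e ^ 2 / σ ^ 2)
  have h2 : |d e| / σ ≤ d e ^ 2 / σ ^ 2 + 1 := by
    rw [← sq_abs (d e), ← div_pow]
    nlinarith [sq_nonneg (|d e| / σ - 1)]
  rw [div_le_iff₀ hσ] at h2
  nlinarith

variable [IsProbabilityMeasure ν]

/-- For `θ ^ 2 * σ ^ 2 ≤ 1` use `exp x ≤ x + exp (x ^ 2)`, whose linear term has mean zero;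
otherwise Young's inequality splits `θ * d` into a constant and half of `d ^ 2 / σ ^ 2`. -/
theorem lintegral_exp_mul_le {d : E → ℝ} {σ : ℝ} (hd : Measurable d) (hσ : 0 < σ)
    (h : ∫⁻ e, ENNReal.ofReal (Real.exp (d e ^ 2 / σ ^ 2)) ∂ν ≤ ENNReal.ofReal (Real.exp 1))
    (h0 : ∫ e, d e ∂ν = 0) (θ : ℝ) :
    ∫⁻ e, ENNReal.ofReal (Real.exp (θ * d e)) ∂ν ≤ ENNReal.ofReal (Real.exp (θ ^ 2 * σ ^ 2)) := by
  have hm : Measurable fun e => d e ^ 2 / σ ^ 2 := (hd.pow_const 2).div_const _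
  have hi := integrable_exp_of_lintegral_le hm h
  have hle := integral_exp_le (Real.exp_pos 1).le hm h
  have hid := integrable_of_lintegral_exp_sq hd hσ h
  -- Convexity of `exp` is applied to the shifted variable `d ^ 2 / σ ^ 2 - 1`, whose exponential
  -- has mean at most `1`; the right side therefore integrates to at most `exp a`.
  have hpow : ∀ a e, 0 ≤ a → a ≤ 1 → Real.exp (a * (d e ^ 2 / σ ^ 2)) ≤
      Real.exp a * (1 - a) + Real.exp a * a * Real.exp (-1) * Real.exp (d e ^ 2 / σ ^ 2) := by
    intro a e ha ha1
    have h1 := exp_mul_le (w := d e ^ 2 / σ ^ 2 - 1) ha ha1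
    have h2 : Real.exp (a * (d e ^ 2 / σ ^ 2)) =
        Real.exp a * Real.exp (a * (d e ^ 2 / σ ^ 2 - 1)) := by
      rw [← Real.exp_add]; ring_nf
    rw [h2]
    refine (mul_le_mul_of_nonneg_left h1 (Real.exp_pos a).le).trans_eq ?_
    rw [sub_eq_add_neg (d e ^ 2 / σ ^ 2), Real.exp_add]
    ring
  have hint : ∀ a, 0 ≤ a → ∫ e, (Real.exp a * (1 - a) +
      Real.exp a * a * Real.exp (-1) * Real.exp (d e ^ 2 / σ ^ 2)) ∂ν ≤ Real.exp a := by
    intro a ha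
    rw [integral_add (integrable_const _) (hi.const_mul _), integral_const, integral_const_mul]
    simp only [probReal_univ, one_smul]
    have h1 := mul_le_mul_of_nonneg_left hle
      (show 0 ≤ Real.exp a * a * Real.exp (-1) by positivity)
    have h2 : Real.exp (-1) * Real.exp 1 = 1 := by rw [← Real.exp_add]; simp
    have h3 : Real.exp a * a * Real.exp (-1) * Real.exp 1 = Real.exp a * a := by
      rw [mul_assoc, h2, mul_one]
    linarith
  rcases le_total (θ ^ 2 * σ ^ 2) 1 with hsmall | hlarge
  · have ha : 0 ≤ θ ^ 2 * σ ^ 2 := by positivity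
    refine lintegral_exp_le_of_le (h := fun e => θ * d e + (Real.exp (θ ^ 2 * σ ^ 2) *
      (1 - θ ^ 2 * σ ^ 2) + Real.exp (θ ^ 2 * σ ^ 2) * (θ ^ 2 * σ ^ 2) * Real.exp (-1) *
        Real.exp (d e ^ 2 / σ ^ 2))) (fun e => ?_)
      ((hid.const_mul θ).add ((integrable_const _).add (hi.const_mul _))) ?_
    · refine (exp_le_add_exp_sq _).trans (add_le_add le_rfl ?_)
      have : (θ * d e) ^ 2 = θ ^ 2 * σ ^ 2 * (d e ^ 2 / σ ^ 2) := by field_simp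
      rw [this]
      exact hpow _ e ha hsmall
    · have hj : Integrable (fun e => Real.exp (θ ^ 2 * σ ^ 2) * (1 - θ ^ 2 * σ ^ 2) +
          Real.exp (θ ^ 2 * σ ^ 2) * (θ ^ 2 * σ ^ 2) * Real.exp (-1) *
            Real.exp (d e ^ 2 / σ ^ 2)) ν := (integrable_const _).add (hi.const_mul _)
      rw [integral_add (hid.const_mul θ) hj, integral_const_mul, h0]
      have := hint _ ha
      linarith
  · refine lintegral_exp_le_of_le (h := fun e => Real.exp (θ ^ 2 * σ ^ 2 / 2) *
      (Real.exp (1 / 2) * (1 - 1 / 2) + Real.exp (1 / 2) * (1 / 2) * Real.exp (-1) *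
        Real.exp (d e ^ 2 / σ ^ 2))) (fun e => ?_)
      (((integrable_const _).add (hi.const_mul _)).const_mul _) ?_
    · have h1 : θ * d e ≤ θ ^ 2 * σ ^ 2 / 2 + 1 / 2 * (d e ^ 2 / σ ^ 2) := by
        have : θ * d e = θ * σ * (d e / σ) := by field_simp
        rw [this, ← div_pow, ← mul_pow]
        nlinarith [sq_nonneg (θ * σ - d e / σ)]
      refine (Real.exp_le_exp.2 h1).trans ?_
      rw [Real.exp_add]
      exact mul_le_mul_of_nonneg_left (hpow _ e (by norm_num) (by norm_num)) (Real.exp_pos _).le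
    · rw [integral_const_mul]
      refine (mul_le_mul_of_nonneg_left (hint (1 / 2) (by norm_num)) (Real.exp_pos _).le).trans ?_
      rw [← Real.exp_add]
      exact Real.exp_le_exp.2 (by linarith)

/-- With `m` the mean, integrate `2 m d - m ^ 2 ≤ d ^ 2 ≤ σ ^ 2 * exp (d ^ 2 / σ ^ 2 - 1)`. -/
theorem sq_integral_le {d : E → ℝ} {σ : ℝ} (hd : Measurable d) (hσ : 0 < σ)
    (h : ∫⁻ e, ENNReal.ofReal (Real.exp (d e ^ 2 / σ ^ 2)) ∂ν ≤ ENNReal.ofReal (Real.exp 1)) :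
    (∫ e, d e ∂ν) ^ 2 ≤ σ ^ 2 := by
  have hm : Measurable fun e => d e ^ 2 / σ ^ 2 := (hd.pow_const 2).div_const _
  have hi := integrable_exp_of_lintegral_le hm h
  have hle := integral_exp_le (Real.exp_pos 1).le hm h
  have hid := integrable_of_lintegral_exp_sq hd hσ h
  set m := ∫ e, d e ∂ν
  have key : ∫ e, (2 * m * d e - m ^ 2) ∂ν ≤
      ∫ e, σ ^ 2 * Real.exp (-1) * Real.exp (d e ^ 2 / σ ^ 2) ∂ν := by
    refine integral_mono ((hid.const_mul _).sub (integrable_const _)) (hi.const_mul _) fun e => ?_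
    have h1 := Real.add_one_le_exp (d e ^ 2 / σ ^ 2 - 1)
    rw [sub_add_cancel, sub_eq_add_neg, Real.exp_add] at h1
    have h2 : d e ^ 2 ≤ σ ^ 2 * (Real.exp (d e ^ 2 / σ ^ 2) * Real.exp (-1)) := by
      rw [mul_comm]; exact (div_le_iff₀ (by positivity)).1 h1
    simp only
    nlinarith [sq_nonneg (d e - m)]
  rw [integral_sub (hid.const_mul _) (integrable_const _), integral_const_mul,
    integral_const_mul] at key
  simp only [integral_const, probReal_univ, one_smul] at key
  have h1 := mul_le_mul_of_nonneg_left hle (show 0 ≤ σ ^ 2 * Real.exp (-1) by positivity)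
  have h2 : Real.exp (-1) * Real.exp 1 = 1 := by rw [← Real.exp_add]; simp
  rw [mul_assoc, mul_assoc, h2, mul_one] at h1
  change 2 * m * m - m ^ 2 ≤ _ at key
  nlinarith

/-- Centering costs a factor `2` in `σ`: `(m - d) ^ 2 ≤ 2 σ ^ 2 + 2 d ^ 2`, and division by `4 σ ^
2` leaves half of the original exponent plus `1 / 2`. -/
theorem lintegral_exp_mul_centered_le {d : E → ℝ} {σ : ℝ} (hd : Measurable d) (hσ : 0 < σ)
    (h : ∫⁻ e, ENNReal.ofReal (Real.exp (d e ^ 2 / σ ^ 2)) ∂ν ≤ ENNReal.ofReal (Real.exp 1))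
    (θ : ℝ) :
    ∫⁻ e, ENNReal.ofReal (Real.exp (θ * (∫ e', d e' ∂ν - d e))) ∂ν ≤
      ENNReal.ofReal (Real.exp (θ ^ 2 * (2 * σ) ^ 2)) := by
  have hm : Measurable fun e => d e ^ 2 / σ ^ 2 := (hd.pow_const 2).div_const _
  have hi := integrable_exp_of_lintegral_le hm h
  have hle := integral_exp_le (Real.exp_pos 1).le hm h
  have hid := integrable_of_lintegral_exp_sq hd hσ h
  have hsq := sq_integral_le hd hσ h
  set m := ∫ e, d e ∂ν
  refine lintegral_exp_mul_le (measurable_const.sub hd) (by positivity) ?_ ?_ θ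
  · refine lintegral_exp_le_of_le
      (h := fun e => 1 / 2 * Real.exp 1 + 1 / 2 * Real.exp (d e ^ 2 / σ ^ 2)) (fun e => ?_)
      ((integrable_const _).add (hi.const_mul _)) ?_
    · have h1 : (m - d e) ^ 2 / (2 * σ) ^ 2 ≤ 1 + 1 / 2 * (d e ^ 2 / σ ^ 2 - 1) := by
        have h3 : 1 + 1 / 2 * (d e ^ 2 / σ ^ 2 - 1) = (2 * σ ^ 2 + 2 * d e ^ 2) / (2 * σ) ^ 2 := by
          field_simp; ring
        rw [h3]
        gcongr
        nlinarith [sq_nonneg (m + d e)]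
      refine (Real.exp_le_exp.2 h1).trans ?_
      have h2 := exp_mul_le (a := 1 / 2) (w := d e ^ 2 / σ ^ 2 - 1) (by norm_num) (by norm_num)
      have h4 : Real.exp (d e ^ 2 / σ ^ 2) = Real.exp 1 * Real.exp (d e ^ 2 / σ ^ 2 - 1) := by
        rw [← Real.exp_add]; ring_nf
      rw [Real.exp_add, h4]
      refine (mul_le_mul_of_nonneg_left h2 (Real.exp_pos 1).le).trans_eq ?_
      ring
    · rw [integral_add (integrable_const _) (hi.const_mul _), integral_const, integral_const_mul]
      simp only [probReal_univ, one_smul]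
      linarith
  · have hz : ∫ e, (m - d e) ∂ν = 0 := by
      rw [integral_sub (integrable_const _) hid]
      simp [m]
    exact hz

end Scalar

/-! ### Concentration of sums adapted to the past of an i.i.d. sequence. -/

section Chain

variable {S E T : Type*} [MeasurableSpace E] [MeasurableSpace T]

/-- The σ-algebra generated by `ξ 0, …, ξ (n - 1)`. -/
@[reducible] def past (ξ : ℕ → S → E) (n : ℕ) : MeasurableSpace S :=
  ⨆ i ∈ Set.Iio n, MeasurableSpace.comap (ξ i) inferInstance

theorem past_mono (ξ : ℕ → S → E) {k n : ℕ} (h : k ≤ n) : past ξ k ≤ past ξ n :=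
  biSup_mono fun _ hi => lt_of_lt_of_le hi h

theorem measurable_past (ξ : ℕ → S → E) {k n : ℕ} (h : k < n) : Measurable[past ξ n] (ξ k) :=
  Measurable.mono (comap_measurable (ξ k))
    (le_iSup₂_of_le (f := fun i (_ : i ∈ Set.Iio n) =>
      MeasurableSpace.comap (ξ i) inferInstance) k h le_rfl) le_rfl

variable [MeasurableSpace S] {μ : Measure S}

theorem past_le {ξ : ℕ → S → E} (hξ : ∀ n, Measurable (ξ n)) (n : ℕ) :
    past ξ n ≤ (inferInstance : MeasurableSpace S) :=
  iSup₂_le fun i _ => (hξ i).comap_le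

theorem indepFun_of_past {ξ : ℕ → S → E} (hξ : ∀ n, Measurable (ξ n)) (hind : iIndepFun ξ μ)
    {n : ℕ} {Z : S → T} (hZ : Measurable[past ξ n] Z) : IndepFun Z (ξ n) μ := by
  have h := indep_iSup_of_disjoint (fun i => (hξ i).comap_le) hind
    (S := Set.Iio n) (T := {n}) (by simp)
  rw [IndepFun_iff_Indep]
  refine indep_of_indep_of_le_left (indep_of_indep_of_le_right h ?_) hZ.comap_le
  exact le_iSup₂_of_le (f := fun i (_ : i ∈ ({n} : Set ℕ)) =>
      MeasurableSpace.comap (ξ i) inferInstance) n rfl le_rfl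

variable [IsProbabilityMeasure μ] {ν : Measure E} [IsProbabilityMeasure ν]

/-- A function of the past is independent of the next sample, so the joint law is a product and
Tonelli applies. This replaces conditional expectations. -/
theorem lintegral_comp_past {ξ : ℕ → S → E} (hξ : ∀ n, Measurable (ξ n)) (hind : iIndepFun ξ μ)
    (hlaw : ∀ n, μ.map (ξ n) = ν) {n : ℕ} {Z : S → T} (hZ : Measurable[past ξ n] Z)
    {g : T × E → ENNReal} (hg : Measurable g) :
    ∫⁻ ω, g (Z ω, ξ n ω) ∂μ = ∫⁻ ω, ∫⁻ e, g (Z ω, e) ∂ν ∂μ := by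
  have hZ' : Measurable Z := hZ.mono (past_le hξ n) le_rfl
  have h := (indepFun_iff_map_prod_eq_prod_map_map hZ'.aemeasurable (hξ n).aemeasurable).1
    (indepFun_of_past hξ hind hZ)
  have : IsProbabilityMeasure (μ.map Z) := Measure.isProbabilityMeasure_map hZ'.aemeasurable
  rw [hlaw] at h
  rw [← lintegral_map (f := g) hg (hZ'.prodMk (hξ n)), h, lintegral_prod _ hg.aemeasurable,
    lintegral_map hg.lintegral_prod_right' hZ']

variable {ξ : ℕ → S → E} (hξ : ∀ n, Measurable (ξ n)) (hind : iIndepFun ξ μ)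
  (hlaw : ∀ n, μ.map (ξ n) = ν) {W : ℕ → S → T} (hW : ∀ n, Measurable[past ξ n] (W n))

include hξ hind hlaw hW

/-- The last factor is integrated first, the past being frozen. -/
theorem lintegral_exp_sum_le {h : ℕ → T × E → ℝ} (hh : ∀ s, Measurable (h s)) {c : ℕ → ℝ}
    (hb : ∀ s w, ∫⁻ e, ENNReal.ofReal (Real.exp (h s (w, e))) ∂ν ≤
      ENNReal.ofReal (Real.exp (c s))) (N : ℕ) :
    ∫⁻ ω, ENNReal.ofReal (Real.exp (∑ s ∈ Finset.range N, h s (W s ω, ξ s ω))) ∂μ ≤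
      ENNReal.ofReal (Real.exp (∑ s ∈ Finset.range N, c s)) := by
  induction N with
  | zero => simp
  | succ N ih =>
    have hsum : Measurable[past ξ N]
        fun ω => ∑ s ∈ Finset.range N, h s (W s ω, ξ s ω) := by
      refine Finset.measurable_fun_sum _ fun s hs => (hh s).comp (Measurable.prodMk ?_ ?_)
      · exact (hW s).mono (past_mono ξ (Finset.mem_range.1 hs).le) le_rfl
      · exact measurable_past ξ (Finset.mem_range.1 hs)
    have hZ : Measurable[past ξ N]
        fun ω => (∑ s ∈ Finset.range N, h s (W s ω, ξ s ω), W N ω) :=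
      Measurable.prodMk hsum (hW N)
    have hg : Measurable fun q : (ℝ × T) × E => ENNReal.ofReal (Real.exp q.1.1) *
        ENNReal.ofReal (Real.exp (h N (q.1.2, q.2))) := by
      have := hh N
      fun_prop
    have h1 := lintegral_comp_past hξ hind hlaw hZ hg
    simp_rw [Finset.sum_range_succ, Real.exp_add, ENNReal.ofReal_mul (Real.exp_pos _).le]
    simp only at h1
    rw [h1]
    have hm : ∀ w, Measurable fun e => ENNReal.ofReal (Real.exp (h N (w, e))) := fun w => by
      have := hh N
      fun_prop
    simp_rw [lintegral_const_mul _ (hm _)]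
    refine (lintegral_mono fun ω => mul_le_mul_right (hb N (W N ω)) _).trans ?_
    rw [lintegral_mul_const]
    · exact mul_le_mul_left ih _
    · exact (hsum.mono (past_le hξ N) le_rfl).exp.ennreal_ofReal

theorem measure_sum_ge_le {d : T × E → ℝ} (hd : Measurable d) {σ : ℝ} (hσ : 0 < σ)
    (hb : ∀ w θ, ∫⁻ e, ENNReal.ofReal (Real.exp (θ * d (w, e))) ∂ν ≤
      ENNReal.ofReal (Real.exp (θ ^ 2 * σ ^ 2))) (γ : ℕ → ℝ) {N : ℕ} {L : ℝ} (hL : 0 ≤ L)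
    (hγ : 0 < ∑ s ∈ Finset.range N, γ s ^ 2) :
    μ {ω | 2 * σ * √((∑ s ∈ Finset.range N, γ s ^ 2) * L) ≤
      ∑ s ∈ Finset.range N, γ s * d (W s ω, ξ s ω)} ≤ ENNReal.ofReal (Real.exp (-L)) := by
  set G := ∑ s ∈ Finset.range N, γ s ^ 2
  -- The optimal Chernoff parameter: the moment exponent becomes `L` and the threshold becomes `2 *
  -- L`, so Markov leaves `exp (-L)`.
  set θ := √(L / G) / σ
  have hθ : 0 ≤ θ := by positivity
  have h1 := lintegral_exp_sum_le hξ hind hlaw hW (h := fun s q => θ * γ s * d q)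
    (fun s => hd.const_mul _) (c := fun s => (θ * γ s) ^ 2 * σ ^ 2) (fun s w => hb w _) N
  have h2 : ∑ s ∈ Finset.range N, (θ * γ s) ^ 2 * σ ^ 2 = L := by
    have : ∑ s ∈ Finset.range N, (θ * γ s) ^ 2 * σ ^ 2 = θ ^ 2 * σ ^ 2 * G := by
      rw [Finset.mul_sum]; exact Finset.sum_congr rfl fun s _ => by ring
    rw [this]
    simp only [θ, div_pow]
    rw [Real.sq_sqrt (by positivity)]
    field_simp
  rw [h2] at h1
  have h3 : θ * (2 * σ * √(G * L)) = 2 * L := by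
    simp only [θ]
    have : √(L / G) * √(G * L) = L := by
      rw [← Real.sqrt_mul (by positivity), show L / G * (G * L) = L ^ 2 by field_simp,
        Real.sqrt_sq hL]
    calc _ = 2 * (√(L / G) * √(G * L)) := by field_simp
      _ = _ := by rw [this]
  have h4 := meas_ge_le_lintegral_div (μ := μ) (ε := ENNReal.ofReal (Real.exp (2 * L)))
    (f := fun ω => ENNReal.ofReal (Real.exp (∑ s ∈ Finset.range N, θ * γ s * d (W s ω, ξ s ω))))
    (by
      refine (Measurable.exp (Finset.measurable_fun_sum _ fun s _ => ?_)).ennreal_ofReal.aemeasurable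
      exact (hd.comp (((hW s).mono (past_le hξ s) le_rfl).prodMk (hξ s))).const_mul _)
    (by simp [Real.exp_pos]) ENNReal.ofReal_ne_top
  refine (measure_mono fun ω hω => ?_).trans (h4.trans ?_)
  · refine ENNReal.ofReal_le_ofReal (Real.exp_le_exp.2 ?_)
    rw [← h3]
    refine (mul_le_mul_of_nonneg_left hω hθ).trans_eq ?_
    rw [Finset.mul_sum]
    exact Finset.sum_congr rfl fun s _ => by ring
  · refine (ENNReal.div_le_div_right h1 _).trans_eq ?_
    rw [← ENNReal.ofReal_div_of_pos (Real.exp_pos _), ← Real.exp_sub]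
    ring_nf

/-- Convexity of `exp` with weights `a s / G` reduces to one term at a time, after which Markov is
applied at `exp (1 + L)`. -/
theorem measure_weighted_sum_ge_le {R : T × E → ℝ} (hR : Measurable R)
    (hb : ∀ w, ∫⁻ e, ENNReal.ofReal (Real.exp (R (w, e))) ∂ν ≤ ENNReal.ofReal (Real.exp 1))
    {a : ℕ → ℝ} (ha : ∀ s, 0 ≤ a s) {N : ℕ} (hpos : 0 < ∑ s ∈ Finset.range N, a s) (L : ℝ) :
    μ {ω | (1 + L) * ∑ s ∈ Finset.range N, a s ≤ ∑ s ∈ Finset.range N, a s * R (W s ω, ξ s ω)} ≤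
      ENNReal.ofReal (Real.exp (-L)) := by
  set G := ∑ s ∈ Finset.range N, a s
  have hmeas : ∀ s, Measurable fun ω => R (W s ω, ξ s ω) := fun s =>
    hR.comp (((hW s).mono (past_le hξ s) le_rfl).prodMk (hξ s))
  have hw1 : ∑ s ∈ Finset.range N, a s / G = 1 := by
    rw [← Finset.sum_div]; exact div_self hpos.ne'
  have h1 : ∫⁻ ω, ENNReal.ofReal (Real.exp (∑ s ∈ Finset.range N, a s / G * R (W s ω, ξ s ω))) ∂μ
      ≤ ENNReal.ofReal (Real.exp 1) := by
    calc _ ≤ ∫⁻ ω, ∑ s ∈ Finset.range N, ENNReal.ofReal (a s / G) *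
          ENNReal.ofReal (Real.exp (R (W s ω, ξ s ω))) ∂μ := by
          refine lintegral_mono fun ω => ?_
          have := convexOn_exp.map_sum_le (t := Finset.range N) (w := fun s => a s / G)
            (p := fun s => R (W s ω, ξ s ω)) (fun s _ => div_nonneg (ha s) hpos.le) hw1
            (fun _ _ => Set.mem_univ _)
          simp only [smul_eq_mul] at this
          refine (ENNReal.ofReal_le_ofReal this).trans_eq ?_
          rw [ENNReal.ofReal_sum_of_nonneg fun s _ =>
            mul_nonneg (div_nonneg (ha s) hpos.le) (Real.exp_pos _).le]
          exact Finset.sum_congr rfl fun s _ =>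
            ENNReal.ofReal_mul (div_nonneg (ha s) hpos.le)
      _ = ∑ s ∈ Finset.range N, ENNReal.ofReal (a s / G) *
          ∫⁻ ω, ENNReal.ofReal (Real.exp (R (W s ω, ξ s ω))) ∂μ := by
          rw [lintegral_finsetSum _ fun s _ => (hmeas s).exp.ennreal_ofReal.const_mul _]
          exact Finset.sum_congr rfl fun s _ =>
            lintegral_const_mul _ (hmeas s).exp.ennreal_ofReal
      _ ≤ ∑ s ∈ Finset.range N, ENNReal.ofReal (a s / G) * ENNReal.ofReal (Real.exp 1) := by
          refine Finset.sum_le_sum fun s _ => mul_le_mul_right ?_ _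
          rw [lintegral_comp_past (g := fun q => ENNReal.ofReal (Real.exp (R q))) hξ hind hlaw
            (hW s) hR.exp.ennreal_ofReal]
          exact (lintegral_mono fun ω => hb (W s ω)).trans (by simp)
      _ = _ := by
          rw [← Finset.sum_mul, ← ENNReal.ofReal_sum_of_nonneg
            fun s _ => div_nonneg (ha s) hpos.le, hw1]
          simp
  have h4 := meas_ge_le_lintegral_div (μ := μ) (ε := ENNReal.ofReal (Real.exp (1 + L)))
    (f := fun ω => ENNReal.ofReal (Real.exp (∑ s ∈ Finset.range N, a s / G * R (W s ω, ξ s ω))))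
    (Measurable.exp (Finset.measurable_fun_sum _ fun s _ =>
      (hmeas s).const_mul _)).ennreal_ofReal.aemeasurable
    (by simp [Real.exp_pos]) ENNReal.ofReal_ne_top
  refine (measure_mono fun ω hω => ?_).trans (h4.trans ?_)
  · refine ENNReal.ofReal_le_ofReal (Real.exp_le_exp.2 ?_)
    have h5 : ∑ s ∈ Finset.range N, a s / G * R (W s ω, ξ s ω) =
        (∑ s ∈ Finset.range N, a s * R (W s ω, ξ s ω)) / G := by
      rw [Finset.sum_div]; exact Finset.sum_congr rfl fun s _ => by ring
    rw [h5, le_div_iff₀ hpos]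
    exact hω
  · refine (ENNReal.div_le_div_right h1 _).trans_eq ?_
    rw [← ENNReal.ofReal_div_of_pos (Real.exp_pos _), ← Real.exp_sub]
    ring_nf

end Chain

end LevelSet

namespace LevelSet

/-! ### Step-length sums and the iteration bound. -/

theorem stepLength_pos {M : ℝ} (hM : 0 < M) (t : ℕ) : 0 < stepLength M t := by
  unfold stepLength; positivity

theorem le_sum_stepLength {M : ℝ} (hM : 0 < M) (N : ℕ) :
    2 * (√((N : ℝ) + 1) - 1) / M ≤ ∑ s ∈ Finset.range N, stepLength M s := by
  induction N with
  | zero => simp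
  | succ N ih =>
    rw [Finset.sum_range_succ]
    have h : 2 * (√(((N + 1 : ℕ) : ℝ) + 1) - √((N : ℝ) + 1)) / M ≤ stepLength M N := by
      unfold stepLength
      have ha : 0 < √((N : ℝ) + 1) := by positivity
      have ha2 : √((N : ℝ) + 1) ^ 2 = N + 1 := Real.sq_sqrt (by positivity)
      have hb2 : √(((N + 1 : ℕ) : ℝ) + 1) ^ 2 = (N + 1 : ℕ) + 1 := Real.sq_sqrt (by positivity)
      push_cast at hb2 ⊢
      rw [div_le_div_iff₀ hM (by positivity)]
      have : 2 * (√((N : ℝ) + 1 + 1) - √((N : ℝ) + 1)) * √((N : ℝ) + 1) ≤ 1 := by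
        nlinarith [sq_nonneg (√((N : ℝ) + 1 + 1) - √((N : ℝ) + 1))]
      nlinarith
    have : 2 * (√(((N + 1 : ℕ) : ℝ) + 1) - 1) / M = 2 * (√((N : ℝ) + 1) - 1) / M +
        2 * (√(((N + 1 : ℕ) : ℝ) + 1) - √((N : ℝ) + 1)) / M := by ring
    linarith

theorem sum_sq_stepLength_le (M : ℝ) (N : ℕ) :
    ∑ s ∈ Finset.range N, stepLength M s ^ 2 ≤ (1 + Real.log N) / M ^ 2 := by
  have h : ∑ s ∈ Finset.range N, stepLength M s ^ 2 = (harmonic N : ℝ) / M ^ 2 := by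
    rw [harmonic, Rat.cast_sum, Finset.sum_div]
    refine Finset.sum_congr rfl fun s _ => ?_
    rw [stepLength, div_pow, mul_pow, Real.sq_sqrt (by positivity)]
    push_cast
    field_simp
  rw [h]
  have := harmonic_le_one_add_log N
  gcongr

/-- The maximum of `log u / u` is `1 / e`, and `27 / 10 < e`. -/
theorem log_le_div_of_pos {u : ℝ} (hu : 0 < u) : Real.log u ≤ u / (27 / 10) := by
  have h1 := Real.log_le_sub_one_of_pos (show 0 < u / (27 / 10) by positivity)
  rw [Real.log_div hu.ne' (by norm_num)] at h1
  have h2 : Real.log (27 / 10) ≤ 1 := by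
    rw [Real.log_le_iff_le_exp (by norm_num)]
    linarith [Real.exp_one_gt_d9]
  linarith

/-- Inverts `2 x log x ≤ u` into `x log u = O(u)`. For small `x`, `log u ≤ u / 2.7` suffices and
gives `2.9 u`. For large `x`, put `u₀ = 2 x log x`: then `log u ≤ log u₀ + u / u₀ - 1` and `log u₀ ≤
2 log x` give `4 u`. -/
theorem mul_one_add_two_log_le {x u : ℝ} (hx : 0 < x) (hu : 3 ≤ u)
    (h : 2 * x * Real.log x ≤ u) : x * (1 + 2 * Real.log u) ≤ 108 / 25 * u := by
  have hu0 : 0 < u := by linarith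
  rcases le_total x (27 / 10) with hx1 | hx1
  · have h1 := log_le_div_of_pos hu0
    have h2 : x * (1 + 2 * Real.log u) ≤ x * (u / 3 + 2 * (u / (27 / 10))) :=
      mul_le_mul_of_nonneg_left (by linarith) hx.le
    have h3 : x * (u / 3 + 2 * (u / (27 / 10))) ≤ (27 / 10) * (u / 3 + 2 * (u / (27 / 10))) :=
      mul_le_mul_of_nonneg_right hx1 (by positivity)
    linarith
  · have hlog : (3 / 5) ≤ Real.log x := by
      have := Real.one_sub_inv_le_log_of_pos hx
      have h2 : x⁻¹ ≤ (27 / 10)⁻¹ := inv_anti₀ (by norm_num) hx1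
      norm_num at h2 ⊢
      linarith
    have hl0 : 0 < Real.log x := by linarith
    set u₀ := 2 * x * Real.log x with hu₀
    have hu₀0 : 0 < u₀ := by positivity
    have h1 := Real.log_le_sub_one_of_pos (show 0 < u / u₀ by positivity)
    rw [Real.log_div hu0.ne' hu₀0.ne'] at h1
    have h2 : Real.log u₀ ≤ 2 * Real.log x := by
      have h3 : u₀ ≤ x ^ 2 := by
        have := log_le_div_of_pos hx
        have h4 : 2 * Real.log x ≤ x := by linarith
        nlinarith
      calc Real.log u₀ ≤ Real.log (x ^ 2) := Real.log_le_log hu₀0 h3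
        _ = _ := by rw [Real.log_pow]; norm_num
    have h5 : x * (1 + 2 * Real.log u) ≤ x * (4 * Real.log x + 2 * (u / u₀)) :=
      mul_le_mul_of_nonneg_left (by linarith) hx.le
    have h6 : x * (4 * Real.log x + 2 * (u / u₀)) = 2 * u₀ + u / Real.log x := by
      rw [hu₀]; field_simp; ring
    have h7 : u / Real.log x ≤ u / (3 / 5) := by gcongr
    have h8 : u / (3 / 5) ≤ 2 * u := by
      rw [div_le_iff₀ (by norm_num)]; linarith
    linarith

/-- The previous lemma with `x = 8 K / ε` and `u = √(N + 3)`. -/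
theorem rate_le {K ε : ℝ} (hK : 0 < K) (hε : 0 < ε) {N : ℕ} (hN : 6 ≤ N)
    (h : (16 * K / ε * Real.log (8 * K / ε)) ^ 2 ≤ (N : ℝ) + 3) :
    K * (1 + Real.log N) ≤ ε / 2 * (2 * (√((N : ℝ) + 1) - 1)) := by
  have hN' : (6 : ℝ) ≤ N := by exact_mod_cast hN
  set u := √((N : ℝ) + 3) with hu
  have hu2 : u ^ 2 = N + 3 := Real.sq_sqrt (by positivity)
  have hu3 : 3 ≤ u := Real.le_sqrt_of_sq_le (by linarith)
  have hx : 0 < 8 * K / ε := by positivity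
  have h1 : 2 * (8 * K / ε) * Real.log (8 * K / ε) ≤ u := by
    refine Real.le_sqrt_of_sq_le ?_
    convert h using 2
    ring
  have h2 := mul_one_add_two_log_le hx hu3 h1
  have h3 : Real.log N ≤ 2 * Real.log u := by
    have : 2 * Real.log u = Real.log (u ^ 2) := by rw [Real.log_pow]; norm_num
    rw [this, hu2]
    exact Real.log_le_log (by linarith) (by linarith)
  -- At `N = 6` the ratio is `(√7 - 1) / 3 > 27 / 50`; the constant `108 / 25` of `h2` is `8 * (27 /
  -- 50)`.
  have h4 : 27 / 50 * u ≤ √((N : ℝ) + 1) - 1 := by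
    rw [le_sub_iff_add_le]
    refine Real.le_sqrt_of_sq_le ?_
    nlinarith
  have h5 : 8 * K / ε * (1 + 2 * Real.log u) * ε = 8 * (K * (1 + 2 * Real.log u)) := by
    field_simp
  have h6 := mul_le_mul_of_nonneg_right h2 hε.le
  have h7 := mul_le_mul_of_nonneg_left h3 hK.le
  have h8 := mul_le_mul_of_nonneg_left h4 hε.le
  rw [h5] at h6
  linarith

/-! ### The constant `Ω(δ)`. -/

section Omega

variable {δ : ℝ}

theorem log_div_pos (hδ : 0 < δ) (hδ1 : δ < 1) : 0 < Real.log (24 / δ) :=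
  Real.log_pos ((one_lt_div hδ).2 (by linarith))

theorem log_le_constOmega : 4 / 3 * Real.log (24 / δ) ≤ constOmega δ := le_max_right _ _

theorem log_le_sq_constOmega (hδ : 0 < δ) (hδ1 : δ < 1) :
    12 * Real.log (24 / δ) ≤ constOmega δ ^ 2 := by
  have := log_div_pos hδ hδ1
  rw [← Real.sq_sqrt (show 0 ≤ 12 * Real.log (24 / δ) by positivity)]
  exact pow_le_pow_left₀ (Real.sqrt_nonneg _) (le_max_left _ _) 2

theorem constOmega_pos (hδ : 0 < δ) (hδ1 : δ < 1) : 0 < constOmega δ := by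
  have := log_div_pos hδ hδ1
  exact lt_of_lt_of_le (by positivity) log_le_constOmega

/-- Uses `12 ≥ 3.4 ^ 2 = 11.56` and `l ≤ l ^ 2`. -/
theorem mul_sqrt_le {M G l : ℝ} (hδ : 0 < δ) (hδ1 : δ < 1) (hM : 0 < M) (hl : 1 ≤ l)
    (hG : G ≤ l / M ^ 2) : M * √(G * Real.log (24 / δ)) ≤ l * constOmega δ / 3.4 := by
  have hL := log_div_pos hδ hδ1
  have hΩ := constOmega_pos hδ hδ1
  have h : √(G * Real.log (24 / δ)) ≤ l * constOmega δ / 3.4 / M := by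
    refine Real.sqrt_le_iff.2 ⟨by positivity, ?_⟩
    calc G * Real.log (24 / δ) ≤ l / M ^ 2 * (constOmega δ ^ 2 / 12) :=
          mul_le_mul hG (by linarith [log_le_sq_constOmega hδ hδ1]) hL.le (by positivity)
      _ ≤ l ^ 2 / M ^ 2 * (constOmega δ ^ 2 / 11.56) := by
          gcongr
          · nlinarith
          · norm_num
      _ = _ := by ring
  rw [le_div_iff₀ hM] at h
  linarith

end Omega

end LevelSet

namespace LevelSet

/-! ### The simplex. -/

section Simplex

variable {k : ℕ}

theorem simplex_convex : Convex ℝ (simplex k) := by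
  intro x hx y hy a b ha hb hab
  refine ⟨fun i => ?_, ?_⟩
  · have := hx.1 i
    have := hy.1 i
    simp only [PiLp.add_apply, PiLp.smul_apply, smul_eq_mul]
    positivity
  · simp only [PiLp.add_apply, PiLp.smul_apply, smul_eq_mul, Finset.sum_add_distrib,
      ← Finset.mul_sum, hx.2, hy.2]
    linarith

theorem simplex_isClosed : IsClosed (simplex k) := by
  have h1 : IsClosed {y : Vec k | ∀ i, 0 ≤ y i} := by
    rw [Set.ofPred_forall]
    exact isClosed_iInter fun i => isClosed_le continuous_const (by fun_prop)
  have h2 : IsClosed {y : Vec k | ∑ i, y i = 1} := isClosed_eq (by fun_prop) continuous_const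
  exact h1.inter h2

theorem single_mem_simplex (i : Fin k) : EuclideanSpace.single i (1 : ℝ) ∈ simplex k := by
  refine ⟨fun j => ?_, ?_⟩
  · rw [PiLp.single_apply]; split_ifs <;> norm_num
  · simp

theorem simplex_nontrivial {m : ℕ} (hm : 1 ≤ m) : (simplex (m + 1)).Nontrivial := by
  refine ⟨_, single_mem_simplex 0, _, single_mem_simplex (Fin.last m), fun h => ?_⟩
  have h1 := congrArg (fun y : Vec (m + 1) => y 0) h
  simp only [PiLp.single_apply] at h1
  simp at h1
  omega

end Simplex

/-! ### The saddle function, `P` and `H`. -/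

namespace SOEC

universe u

variable {d m : ℕ} {Ξ : Fin (m + 1) → Type u} [∀ i, MeasurableSpace (Ξ i)]
  (p : SOEC d m Ξ) (r : ℝ) {F' : ∀ i, Vec d → Ξ i → Vec d}

/-- The vector `(fᵢ(x) - rᵢ)ᵢ`, the expectation of `Gy`. -/
noncomputable def gy (x : Vec d) : Vec (m + 1) := WithLp.toLp 2 fun i => p.f i x - p.lvl r i

instance : IsProbabilityMeasure p.law := p.law_prob

/-- On a one-point `X` the strictly feasible point would be optimal. Two points are needed for a
positive diameter, by which `ω` is normalized. -/
theorem X_nontrivial {p : SOEC d m Ξ} (hp : p.StrictlyFeasible) : p.X.Nontrivial := by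
  obtain ⟨x, hx, hfeas, hlt⟩ := hp
  by_contra hnt
  rw [Set.not_nontrivial_iff] at hnt
  have hfe : p.feasible = {x} := by
    refine Set.eq_singleton_iff_unique_mem.2 ⟨⟨hx, fun i => by linarith [hfeas i]⟩, ?_⟩
    exact fun y hy => hnt hy.1 hx
  rw [fstar, hfe, Set.image_singleton, csInf_singleton] at hlt
  exact lt_irrefl _ hlt

theorem inner_Gy (x : Vec d) (y : Vec (m + 1)) (ξ : ∀ i, Ξ i) :
    inner ℝ (p.Gy r x ξ) y = p.Phi r x y ξ := by
  simp [Gy, Phi, PiLp.inner_apply]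

theorem inner_gy (x : Vec d) (y : Vec (m + 1)) :
    inner ℝ (p.gy r x) y = ∑ i, y i * (p.f i x - p.lvl r i) := by
  simp [gy, PiLp.inner_apply, mul_comm]

theorem inner_gy_single (x : Vec d) (i : Fin (m + 1)) :
    inner ℝ (p.gy r x) (EuclideanSpace.single i (1 : ℝ)) = p.f i x - p.lvl r i := by
  rw [EuclideanSpace.inner_single_right]
  simp [gy]

theorem integrable_Phi {x : Vec d} (hx : x ∈ p.X) (y : Vec (m + 1)) :
    Integrable (p.Phi r x y) p.law :=
  integrable_finsetSum _ fun i _ =>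
    ((p.F_integrable i x hx).sub (integrable_const _)).const_mul _

theorem phi_eq {x : Vec d} (hx : x ∈ p.X) (y : Vec (m + 1)) :
    p.phi r x y = inner ℝ (p.gy r x) y := by
  rw [inner_gy, phi]
  unfold Phi
  have hi : ∀ i, Integrable (fun ξ : ∀ i, Ξ i => y i * (p.F i x (ξ i) - p.lvl r i)) p.law :=
    fun i => ((p.F_integrable i x hx).sub (integrable_const _)).const_mul _
  rw [integral_finsetSum _ fun i _ => hi i]
  refine Finset.sum_congr rfl fun i _ => ?_
  rw [integral_const_mul, integral_sub (p.F_integrable i x hx) (integrable_const _)]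
  simp [f]

theorem integral_inner_Gy {x : Vec d} (hx : x ∈ p.X) (v : Vec (m + 1)) :
    ∫ ξ, inner ℝ (p.Gy r x ξ) v ∂p.law = inner ℝ (p.gy r x) v := by
  simp_rw [inner_Gy]
  exact p.phi_eq r hx v

theorem f_convexOn (i : Fin (m + 1)) : ConvexOn ℝ p.X (p.f i) := by
  refine ⟨p.X_convex, fun x hx y hy a b ha hb hab => ?_⟩
  simp only [f, smul_eq_mul]
  rw [← integral_const_mul, ← integral_const_mul, ← integral_add
    ((p.F_integrable i x hx).const_mul a) ((p.F_integrable i y hy).const_mul b)]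
  refine integral_mono (p.F_integrable i _ (p.X_convex hx hy ha hb hab))
    (((p.F_integrable i x hx).const_mul a).add ((p.F_integrable i y hy).const_mul b)) fun ξ => ?_
  exact (p.F_convexOn i (ξ i)).2 hx hy ha hb hab

theorem f_sub_le (hF' : p.IsSubgradientSelection F') (i : Fin (m + 1)) {x z : Vec d}
    (hx : x ∈ p.X) (hz : z ∈ p.X) :
    p.f i x - p.f i z ≤ ∫ ξ, inner ℝ (F' i x (ξ i)) (x - z) ∂p.law := by
  rw [f, f, ← integral_sub (p.F_integrable i x hx) (p.F_integrable i z hz)]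
  refine integral_mono ((p.F_integrable i x hx).sub (p.F_integrable i z hz))
    ((hF'.integrable i x hx).inner_const _) fun ξ => ?_
  have h := hF'.mem_subdiff i x hx (ξ i) z hz
  simp only [inner_sub_right] at h ⊢
  linarith

theorem phi_sub_le (hF' : p.IsSubgradientSelection F') {x z : Vec d} {y : Vec (m + 1)}
    (hx : x ∈ p.X) (hz : z ∈ p.X) (hy : y ∈ simplex (m + 1)) :
    p.phi r x y - p.phi r z y ≤ ∫ ξ, inner ℝ (p.Gx F' x y ξ) (x - z) ∂p.law := by
  have h : ∫ ξ, inner ℝ (p.Gx F' x y ξ) (x - z) ∂p.law =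
      ∑ i, y i * ∫ ξ, inner ℝ (F' i x (ξ i)) (x - z) ∂p.law := by
    simp only [Gx, sum_inner, real_inner_smul_left]
    rw [integral_finsetSum _ fun i _ => ((hF'.integrable i x hx).inner_const _).const_mul _]
    simp_rw [integral_const_mul]
  rw [h, p.phi_eq r hx, p.phi_eq r hz, inner_gy, inner_gy, ← Finset.sum_sub_distrib]
  refine Finset.sum_le_sum fun i _ => ?_
  have := mul_le_mul_of_nonneg_left (p.f_sub_le hF' i hx hz) (hy.1 i)
  linarith

theorem phi_le_P {x : Vec d} {y : Vec (m + 1)} (hx : x ∈ p.X) (hy : y ∈ simplex (m + 1)) :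
    p.phi r x y ≤ p.P r x := by
  rw [p.phi_eq r hx, inner_gy]
  calc _ ≤ ∑ i, y i * p.P r x := Finset.sum_le_sum fun i _ => mul_le_mul_of_nonneg_left
          (Finset.le_sup' (fun i => p.f i x - p.lvl r i) (Finset.mem_univ i)) (hy.1 i)
    _ = _ := by rw [← Finset.sum_mul, hy.2, one_mul]

theorem exists_P_eq (x : Vec d) : ∃ i, p.P r x = p.f i x - p.lvl r i := by
  obtain ⟨i, _, hi⟩ := Finset.exists_mem_eq_sup' Finset.univ_nonempty
    fun i => p.f i x - p.lvl r i
  exact ⟨i, hi⟩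

/-- The averaged subgradient of `F 0` at one point gives an affine minorant of `f 0`, bounded below
on the compact `X`. Without this bound the `sInf` in `H` would carry no information. -/
theorem bddBelow_P (A : DistGen p.X) (hF' : p.IsSubgradientSelection F') :
    BddBelow (p.P r '' p.X) := by
  obtain ⟨x₀, hx₀⟩ := p.X_nonempty
  have hK := A.isCompact p.X_convex p.X_closed
  have hint : ∀ z, ∫ ξ, inner ℝ (F' 0 x₀ (ξ 0)) (x₀ - z) ∂p.law =
      inner ℝ (∫ ξ, F' 0 x₀ (ξ 0) ∂p.law) (x₀ - z) := fun z => by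
    simp_rw [real_inner_comm (x₀ - z)]
    exact integral_inner (hF'.integrable 0 x₀ hx₀) _
  obtain ⟨C, hC⟩ := hK.bddAbove_image
    (f := fun z => inner ℝ (∫ ξ, F' 0 x₀ (ξ 0) ∂p.law) (x₀ - z)) (by fun_prop)
  refine ⟨p.f 0 x₀ - C - p.lvl r 0, ?_⟩
  rintro _ ⟨z, hz, rfl⟩
  have h1 := p.f_sub_le hF' 0 hx₀ hz
  rw [hint] at h1
  have h2 : p.f 0 z - p.lvl r 0 ≤ p.P r z :=
    Finset.le_sup' (fun i => p.f i z - p.lvl r i) (Finset.mem_univ 0)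
  have h3 := hC ⟨z, hz, rfl⟩
  simp only at h3
  linarith

theorem H_le (A : DistGen p.X) (hF' : p.IsSubgradientSelection F') {x : Vec d} (hx : x ∈ p.X) :
    p.H r ≤ p.P r x := csInf_le (p.bddBelow_P r A hF') ⟨x, hx, rfl⟩

/-- A near-minimizer suffices, so attainment in `H` is not required. -/
theorem exists_P_le {η : ℝ} (hη : 0 < η) : ∃ x ∈ p.X, p.P r x ≤ p.H r + η := by
  obtain ⟨_, ⟨x, hx, rfl⟩, h⟩ := exists_lt_of_csInf_lt (p.X_nonempty.image (p.P r))
    (lt_add_of_pos_right _ hη)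
  exact ⟨x, hx, h.le⟩

section Measurability

/-- A Carathéodory function, continuous in `x` and measurable in `ξ`, is jointly measurable. -/
theorem measurable_F (i : Fin (m + 1)) : Measurable fun q : p.X × Ξ i => p.F i q.1 q.2 :=
  measurable_uncurry_of_continuous_of_measurable (u := fun (x : p.X) (ξ : Ξ i) => p.F i x ξ)
    (fun ξ => continuousOn_iff_continuous_domRestrict.1 (p.F_continuousOn i ξ))
    fun x => p.F_measurable i x x.2

theorem measurable_Gy : Measurable fun q : p.X × (∀ i, Ξ i) => p.Gy r q.1 q.2 := by
  refine (WithLp.measurable_toLp 2 _).comp (measurable_pi_lambda _ fun i => ?_)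
  exact ((p.measurable_F i).comp
    (measurable_fst.prodMk ((measurable_pi_apply i).comp measurable_snd))).sub_const _

theorem measurable_gy : Measurable fun x : p.X => p.gy r x := by
  refine (WithLp.measurable_toLp 2 _).comp (measurable_pi_lambda _ fun i => ?_)
  refine Measurable.sub_const ?_ _
  have h : Measurable fun q : p.X × (∀ i, Ξ i) => p.F i q.1 (q.2 i) :=
    (p.measurable_F i).comp (measurable_fst.prodMk ((measurable_pi_apply i).comp measurable_snd))
  exact (h.stronglyMeasurable.integral_prod_right' (ν := p.law)).measurable

theorem measurable_Gx (hF' : p.IsSubgradientSelection F') :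
    Measurable fun q : (p.X × Vec (m + 1)) × (∀ i, Ξ i) => p.Gx F' q.1.1 q.1.2 q.2 := by
  refine Finset.measurable_fun_sum _ fun i _ => Measurable.fun_smul ?_ ?_
  · fun_prop
  · exact (hF'.measurable i).comp
      ((measurable_fst.comp measurable_fst).prodMk ((measurable_pi_apply i).comp measurable_snd))

end Measurability

end SOEC

theorem DistGen.measurable_step {n : ℕ} {S : Set (Vec n)} {A : DistGen S} (hS : Convex ℝ S)
    (hcl : IsClosed S) (hD : 0 < A.diam) :
    Measurable fun q : A.dom × Vec n => A.step q.1 q.2 := by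
  have h : Continuous fun x : A.dom => A.grad x :=
    continuousOn_iff_continuous_domRestrict.1 A.grad_continuousOn
  exact ((A.mirror_continuous hS hcl hD).comp (continuous_snd.sub
    ((h.comp continuous_fst).const_smul A.scale))).measurable

end LevelSet

namespace LevelSet

theorem constM_sq {d k : ℕ} {X : Set (Vec d)} {Y : Set (Vec k)} (A : DistGen X) (B : DistGen Y)
    (Mx My : ℝ) : constM A B Mx My ^ 2 = A.ratio * Mx ^ 2 + B.ratio * My ^ 2 := by
  have := A.α_pos
  have := B.α_pos
  rw [constM, Real.sq_sqrt (by positivity), DistGen.ratio, DistGen.ratio]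

theorem constM_pos {d k : ℕ} {X : Set (Vec d)} {Y : Set (Vec k)} {A : DistGen X} {B : DistGen Y}
    (hA : 0 < A.diam) {Mx My : ℝ} (hMx : 0 < Mx) : 0 < constM A B Mx My := by
  have := A.α_pos
  have := B.α_pos
  exact Real.sqrt_pos.2 (by positivity)

theorem measurable_past_of_rec {S E T : Type*} [MeasurableSpace E] [MeasurableSpace T]
    {ξ : ℕ → S → E} {W : ℕ → S → T} {f : ℕ → T × E → T} {w : T} (hf : ∀ n, Measurable (f n))
    (h0 : ∀ ω, W 0 ω = w) (hs : ∀ n ω, W (n + 1) ω = f n (W n ω, ξ n ω)) (n : ℕ) :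
    Measurable[past ξ n] (W n) := by
  induction n with
  | zero =>
    rw [funext h0]
    exact measurable_const
  | succ n ih =>
    rw [funext (hs n)]
    exact (hf n).comp (Measurable.prodMk (ih.mono (past_mono ξ n.le_succ) le_rfl)
      (measurable_past ξ n.lt_succ_self))

/-! ### The OVSMD iterates with the auxiliary sequence, and their light tails. -/

namespace SOEC

universe u

variable {d m : ℕ} {Ξ : Fin (m + 1) → Type u} [∀ i, MeasurableSpace (Ξ i)]
  (p : SOEC d m Ξ) (r : ℝ) (F' : ∀ i, Vec d → Ξ i → Vec d)
  {A : DistGen p.X} {B : DistGen (simplex (m + 1))}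

/-- One step of mirror descent in `x` and in `y`, together with a step of an auxiliary sequence
in the simplex that follows the noise `Gy - gy`. -/
noncomputable def next (hA : 0 < A.diam) (hB : 0 < B.diam) (γ : ℝ) (w : A.dom × B.dom × B.dom)
    (ξ : ∀ i, Ξ i) : A.dom × B.dom × B.dom :=
  (⟨A.step w.1 (γ • p.Gx F' w.1 w.2.1 ξ), A.step_mem_dom p.X_convex p.X_closed hA _ _⟩,
    ⟨B.step w.2.1 (γ • -p.Gy r w.1 ξ), B.step_mem_dom simplex_convex simplex_isClosed hB _ _⟩,
    ⟨B.step w.2.2 (γ • (p.Gy r w.1 ξ - p.gy r w.1)),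
      B.step_mem_dom simplex_convex simplex_isClosed hB _ _⟩)

/-- The iterates together with the auxiliary sequence. -/
noncomputable def chain (hA : 0 < A.diam) (hB : 0 < B.diam) (γ : ℕ → ℝ) (ξ : ℕ → ∀ i, Ξ i) :
    ℕ → A.dom × B.dom × B.dom
  | 0 => (⟨A.mirror 0, A.mirror_mem_dom p.X_convex p.X_closed hA _⟩,
      ⟨B.mirror 0, B.mirror_mem_dom simplex_convex simplex_isClosed hB _⟩,
      ⟨B.mirror 0, B.mirror_mem_dom simplex_convex simplex_isClosed hB _⟩)
  | t + 1 => p.next r F' hA hB (γ t) (chain hA hB γ ξ t) (ξ t)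

/-- The squared dual norm of the stochastic gradient. -/
noncomputable def sqNorm (q : (A.dom × B.dom × B.dom) × (∀ i, Ξ i)) : ℝ :=
  A.ratio * dualNorm A.nrm (p.Gx F' q.1.1 q.1.2.1 q.2) ^ 2 +
    B.ratio * dualNorm B.nrm (p.Gy r q.1.1 q.2) ^ 2

/-- The pairing of the stochastic gradient in `x` with the direction from `z`. -/
noncomputable def slopeX (z : Vec d) (q : (A.dom × B.dom × B.dom) × (∀ i, Ξ i)) : ℝ :=
  inner ℝ (p.Gx F' q.1.1 q.1.2.1 q.2) (q.1.1 - z)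

/-- The pairing of the stochastic gradient in `y` with the direction from the iterate to the
auxiliary sequence. -/
noncomputable def slopeY (q : (A.dom × B.dom × B.dom) × (∀ i, Ξ i)) : ℝ :=
  inner ℝ (p.Gy r q.1.1 q.2) ((q.1.2.2 : Vec (m + 1)) - q.1.2.1)

/-- The noise in the value of the Lagrangian. -/
noncomputable def noise (q : (A.dom × B.dom × B.dom) × (∀ i, Ξ i)) : ℝ :=
  p.Phi r q.1.1 q.1.2.1 q.2 - p.phi r q.1.1 q.1.2.1

variable (hA : 0 < A.diam) (hB : 0 < B.diam)

section Measurability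

variable {F'}

theorem measurable_chain_point :
    Measurable fun q : (A.dom × B.dom × B.dom) × (∀ i, Ξ i) => (⟨q.1.1, q.1.1.2.1⟩ : p.X) :=
  Measurable.subtype_mk (measurable_subtype_coe.comp (measurable_fst.comp measurable_fst))

theorem measurable_chain_Gx (hF' : p.IsSubgradientSelection F') :
    Measurable fun q : (A.dom × B.dom × B.dom) × (∀ i, Ξ i) => p.Gx F' q.1.1 q.1.2.1 q.2 :=
  (p.measurable_Gx hF').comp ((p.measurable_chain_point.prodMk
    (measurable_subtype_coe.comp (measurable_fst.comp (measurable_snd.comp measurable_fst)))).prodMk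
      measurable_snd)

theorem measurable_chain_Gy :
    Measurable fun q : (A.dom × B.dom × B.dom) × (∀ i, Ξ i) => p.Gy r q.1.1 q.2 :=
  (p.measurable_Gy r).comp (p.measurable_chain_point.prodMk measurable_snd)

theorem measurable_chain_gy :
    Measurable fun q : (A.dom × B.dom × B.dom) × (∀ i, Ξ i) => p.gy r q.1.1 :=
  (p.measurable_gy r).comp p.measurable_chain_point

theorem measurable_next (hF' : p.IsSubgradientSelection F') (γ : ℝ) :
    Measurable fun q : (A.dom × B.dom × B.dom) × (∀ i, Ξ i) =>
      p.next r F' hA hB γ q.1 q.2 := by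
  have h1 := A.measurable_step p.X_convex p.X_closed hA
  have h2 := B.measurable_step simplex_convex simplex_isClosed hB
  refine Measurable.prodMk ?_ (Measurable.prodMk ?_ ?_)
  · exact (h1.comp ((measurable_fst.comp measurable_fst).prodMk
      ((p.measurable_chain_Gx hF').const_smul γ))).subtype_mk
  · exact (h2.comp ((measurable_fst.comp (measurable_snd.comp measurable_fst)).prodMk
      ((p.measurable_chain_Gy r).neg.const_smul γ))).subtype_mk
  · exact (h2.comp ((measurable_snd.comp (measurable_snd.comp measurable_fst)).prodMk
      (((p.measurable_chain_Gy r).sub (p.measurable_chain_gy r)).const_smul γ))).subtype_mk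

theorem measurable_sqNorm (hF' : p.IsSubgradientSelection F') :
    Measurable (p.sqNorm r F' (A := A) (B := B)) :=
  ((((dualNorm_continuous A.nrm_definite).measurable.comp
    (p.measurable_chain_Gx hF')).pow_const 2).const_mul _).add
  ((((dualNorm_continuous B.nrm_definite).measurable.comp
    (p.measurable_chain_Gy r)).pow_const 2).const_mul _)

theorem measurable_slopeX (hF' : p.IsSubgradientSelection F') (z : Vec d) :
    Measurable (p.slopeX F' z (A := A) (B := B)) :=
  (p.measurable_chain_Gx hF').inner
    ((measurable_subtype_coe.comp (measurable_fst.comp measurable_fst)).sub_const z)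

theorem measurable_slopeY : Measurable (p.slopeY r (A := A) (B := B)) :=
  (p.measurable_chain_Gy r).inner
    ((measurable_subtype_coe.comp (measurable_snd.comp (measurable_snd.comp measurable_fst))).sub
      (measurable_subtype_coe.comp (measurable_fst.comp (measurable_snd.comp measurable_fst))))

theorem measurable_noise : Measurable (p.noise r (A := A) (B := B)) := by
  have hy : Measurable fun q : (A.dom × B.dom × B.dom) × (∀ i, Ξ i) => (q.1.2.1 : Vec (m + 1)) :=
    measurable_subtype_coe.comp (measurable_fst.comp (measurable_snd.comp measurable_fst))
  have h : (p.noise r (A := A) (B := B)) = fun q =>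
      inner ℝ (p.Gy r q.1.1 q.2) (q.1.2.1 : Vec (m + 1)) -
        inner ℝ (p.gy r q.1.1) (q.1.2.1 : Vec (m + 1)) := by
    funext q
    rw [noise, inner_Gy, p.phi_eq r q.1.1.2.1]
  rw [h]
  exact ((p.measurable_chain_Gy r).inner hy).sub ((p.measurable_chain_gy r).inner hy)

theorem measurable_chain (hF' : p.IsSubgradientSelection F') {S : Type*} (γ : ℕ → ℝ)
    (ξ : ℕ → S → ∀ i, Ξ i) (n : ℕ) :
    Measurable[past ξ n] fun ω => p.chain r F' hA hB γ (fun k => ξ k ω) n := by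
  exact measurable_past_of_rec (ξ := ξ)
    (W := fun n ω => p.chain r F' hA hB γ (fun k => ξ k ω) n) (f := fun n q => p.next r F' hA hB (γ n) q.1 q.2)
    (fun n => p.measurable_next r hA hB hF' (γ n)) (fun _ => rfl) (fun _ _ => rfl) n

end Measurability

theorem iterate_eq (γ : ℕ → ℝ) (ξ : ℕ → ∀ i, Ξ i) (n : ℕ) :
    p.iterate F' r A B γ ξ n =
      (((p.chain r F' hA hB γ ξ n).1 : Vec d), ((p.chain r F' hA hB γ ξ n).2.1 : Vec (m + 1))) := by
  induction n with
  | zero =>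
    exact argminOn_omegaZ p.X_convex p.X_closed hA simplex_convex simplex_isClosed hB
  | succ n ih =>
    rw [iterate, prox_eq p.X_convex p.X_closed hA simplex_convex simplex_isClosed hB, ih]
    rfl

section LightTail

variable {p r F'} {Mx My Q : ℝ} (hl : p.IsLightTailed F' r A B Mx My Q)
  (hMx : 0 < Mx) (hMy : 0 < My)

include hl hMy in
-- The dual norm of a mean is at most the mean dual norm, which `sq_integral_le` bounds by `My`.
theorem dualNorm_gy_le {x : Vec d} (hx : x ∈ p.X) : dualNorm B.nrm (p.gy r x) ≤ My := by
  have hm : Measurable fun ξ => dualNorm B.nrm (p.Gy r x ξ) :=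
    (dualNorm_continuous B.nrm_definite).measurable.comp
      ((p.measurable_Gy r).comp (measurable_const.prodMk measurable_id : Measurable fun ξ =>
        ((⟨x, hx⟩ : p.X), ξ)))
  have hi := integrable_of_lintegral_exp_sq hm hMy (hl.grady x hx)
  have hsq := sq_integral_le hm hMy (hl.grady x hx)
  refine dualNorm_le hMy.le fun v => ?_
  rw [← p.integral_inner_Gy r hx]
  calc _ ≤ ∫ ξ, dualNorm B.nrm (p.Gy r x ξ) * B.nrm v ∂p.law := by
        refine integral_mono ?_ (hi.mul_const _) fun ξ =>
          inner_le_dualNorm_mul B.nrm_definite _ v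
        simp_rw [inner_Gy]
        exact p.integrable_Phi r hx v
    _ ≤ _ := by
        rw [integral_mul_const]
        exact mul_le_mul_of_nonneg_right (abs_le_of_sq_le_sq' hsq hMy.le).2 (apply_nonneg _ _)

include hA hl hMx hMy in
-- By `constM_sq`, `sqNorm / M ^ 2` is a convex combination of the two light-tail exponents, with
-- weights `ratio * Mx ^ 2 / M ^ 2` and `ratio * My ^ 2 / M ^ 2`.
theorem lintegral_exp_sqNorm_le (hF' : p.IsSubgradientSelection F') (w : A.dom × B.dom × B.dom) :
    ∫⁻ ξ, ENNReal.ofReal (Real.exp (p.sqNorm r F' (w, ξ) / constM A B Mx My ^ 2)) ∂p.law ≤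
      ENNReal.ofReal (Real.exp 1) := by
  have hM := constM_pos (B := B) (My := My) hA hMx
  have hMsq := constM_sq A B Mx My
  set M := constM A B Mx My
  have hx := w.1.2.1
  have hm1 : Measurable fun ξ => dualNorm A.nrm (p.Gx F' w.1 w.2.1 ξ) ^ 2 / Mx ^ 2 :=
    ((((dualNorm_continuous A.nrm_definite).measurable.comp ((p.measurable_chain_Gx hF').comp
      (measurable_const.prodMk measurable_id : Measurable fun ξ => (w, ξ)))).pow_const 2)).div_const _
  have hm2 : Measurable fun ξ => dualNorm B.nrm (p.Gy r w.1 ξ) ^ 2 / My ^ 2 :=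
    ((((dualNorm_continuous B.nrm_definite).measurable.comp ((p.measurable_chain_Gy r).comp
      (measurable_const.prodMk measurable_id : Measurable fun ξ => (w, ξ)))).pow_const 2)).div_const _
  have h1 := hl.gradx w.1 hx w.2.1 w.2.1.2.1
  have h2 := hl.grady w.1 hx
  have hi1 := integrable_exp_of_lintegral_le hm1 h1
  have hi2 := integrable_exp_of_lintegral_le hm2 h2
  have hle1 := integral_exp_le (Real.exp_pos 1).le hm1 h1
  have hle2 := integral_exp_le (Real.exp_pos 1).le hm2 h2
  have hAr : 0 < A.ratio := A.ratio_pos hA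
  have hBr : 0 ≤ B.ratio := div_nonneg (by positivity) B.α_pos.le
  have ha : 0 ≤ A.ratio * Mx ^ 2 / M ^ 2 := by positivity
  have hb : 0 ≤ B.ratio * My ^ 2 / M ^ 2 := by positivity
  have hab : A.ratio * Mx ^ 2 / M ^ 2 + B.ratio * My ^ 2 / M ^ 2 = 1 := by
    rw [← add_div, ← hMsq, div_self (by positivity)]
  refine lintegral_exp_le_of_le (h := fun ξ =>
    A.ratio * Mx ^ 2 / M ^ 2 * Real.exp (dualNorm A.nrm (p.Gx F' w.1 w.2.1 ξ) ^ 2 / Mx ^ 2) +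
    B.ratio * My ^ 2 / M ^ 2 * Real.exp (dualNorm B.nrm (p.Gy r w.1 ξ) ^ 2 / My ^ 2))
    (fun ξ => ?_) ((hi1.const_mul _).add (hi2.const_mul _)) ?_
  · have := convexOn_exp.2 (Set.mem_univ (dualNorm A.nrm (p.Gx F' w.1 w.2.1 ξ) ^ 2 / Mx ^ 2))
      (Set.mem_univ (dualNorm B.nrm (p.Gy r w.1 ξ) ^ 2 / My ^ 2)) ha hb hab
    simp only [smul_eq_mul] at this
    refine le_trans (le_of_eq ?_) this
    congr 1
    simp only [sqNorm]
    field_simp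
  · rw [integral_add (hi1.const_mul _) (hi2.const_mul _), integral_const_mul, integral_const_mul]
    calc _ ≤ A.ratio * Mx ^ 2 / M ^ 2 * Real.exp 1 + B.ratio * My ^ 2 / M ^ 2 * Real.exp 1 := by
          gcongr
      _ = _ := by rw [← add_mul, hab, one_mul]

/-- The factor `2 * M` comes from the bound `2 √ratio` on distances in `S`. -/
theorem sq_inner_div_le {n : ℕ} {S : Set (Vec n)} {A : DistGen S} (hS : Convex ℝ S)
    {ζ x z : Vec n} (hx : x ∈ S) (hz : z ∈ S) {M K : ℝ} (hM : 0 < M)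
    (hK : 0 < K) (h : A.ratio * K ^ 2 ≤ M ^ 2) :
    inner ℝ ζ (x - z) ^ 2 / (2 * M) ^ 2 ≤ dualNorm A.nrm ζ ^ 2 / K ^ 2 := by
  have h1 : inner ℝ ζ (x - z) ^ 2 ≤ dualNorm A.nrm ζ ^ 2 * (4 * A.ratio) := by
    calc inner ℝ ζ (x - z) ^ 2 = |inner ℝ ζ (x - z)| ^ 2 := (sq_abs _).symm
      _ ≤ (dualNorm A.nrm ζ * A.nrm (x - z)) ^ 2 :=
          pow_le_pow_left₀ (abs_nonneg _) (abs_inner_le_dualNorm_mul A.nrm_definite _ _) 2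
      _ = dualNorm A.nrm ζ ^ 2 * A.nrm (x - z) ^ 2 := by ring
      _ ≤ _ := mul_le_mul_of_nonneg_left (A.sq_nrm_sub_le hS hx hz) (sq_nonneg _)
  rw [div_le_div_iff₀ (by positivity) (by positivity)]
  calc _ ≤ dualNorm A.nrm ζ ^ 2 * (4 * A.ratio) * K ^ 2 := by gcongr
    _ = 4 * dualNorm A.nrm ζ ^ 2 * (A.ratio * K ^ 2) := by ring
    _ ≤ 4 * dualNorm A.nrm ζ ^ 2 * M ^ 2 := by gcongr
    _ = _ := by ring

include hA hl hMx in
theorem lintegral_exp_sq_slopeX_le {z : Vec d} (hz : z ∈ p.X) (w : A.dom × B.dom × B.dom) :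
    ∫⁻ ξ, ENNReal.ofReal (Real.exp (p.slopeX F' z (w, ξ) ^ 2 / (2 * constM A B Mx My) ^ 2)) ∂p.law
      ≤ ENNReal.ofReal (Real.exp 1) := by
  refine (lintegral_mono fun ξ => ENNReal.ofReal_le_ofReal (Real.exp_le_exp.2 ?_)).trans
    (hl.gradx w.1 w.1.2.1 w.2.1 w.2.1.2.1)
  refine sq_inner_div_le p.X_convex w.1.2.1 hz (constM_pos hA hMx) hMx ?_
  have hBr : 0 ≤ B.ratio := div_nonneg (by positivity) B.α_pos.le
  rw [constM_sq]
  linarith [mul_nonneg hBr (sq_nonneg My)]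

include hA hl hMx hMy in
theorem lintegral_exp_sq_slopeY_le (w : A.dom × B.dom × B.dom) :
    ∫⁻ ξ, ENNReal.ofReal (Real.exp (p.slopeY r (w, ξ) ^ 2 / (2 * constM A B Mx My) ^ 2)) ∂p.law
      ≤ ENNReal.ofReal (Real.exp 1) := by
  refine (lintegral_mono fun ξ => ENNReal.ofReal_le_ofReal (Real.exp_le_exp.2 ?_)).trans
    (hl.grady w.1 w.1.2.1)
  refine sq_inner_div_le simplex_convex w.2.2.2.1 w.2.1.2.1 (constM_pos hA hMx) hMy ?_
  have hAr : 0 ≤ A.ratio := (A.ratio_pos hA).le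
  rw [constM_sq]
  linarith [mul_nonneg hAr (sq_nonneg Mx)]

include hl in
theorem lintegral_exp_noise_le (hQ : 0 < Q) (w : A.dom × B.dom × B.dom) (θ : ℝ) :
    ∫⁻ ξ, ENNReal.ofReal (Real.exp (θ * p.noise r (w, ξ))) ∂p.law ≤
      ENNReal.ofReal (Real.exp (θ ^ 2 * Q ^ 2)) := by
  have hx := w.1.2.1
  refine lintegral_exp_mul_le ((p.measurable_noise r).comp
    (measurable_const.prodMk measurable_id : Measurable fun ξ => (w, ξ))) hQ ?_ ?_ θ
  · have := hl.obj w.1 hx w.2.1 w.2.1.2.1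
    simp only [sq_abs] at this
    exact this
  · have h0 : ∫ ξ, (p.Phi r w.1 w.2.1 ξ - p.phi r w.1 w.2.1) ∂p.law = 0 := by
      rw [integral_sub (p.integrable_Phi r hx _) (integrable_const _)]
      simp [phi]
    exact h0

end LightTail

/-! ### Regret bounds along the iterates. -/

section Regret

variable (γ : ℕ → ℝ) (ξ : ℕ → ∀ i, Ξ i)

theorem regret_le (hγ : ∀ s, 0 ≤ γ s) {z : Vec d} (hz : z ∈ p.X) {y : Vec (m + 1)}
    (hy : y ∈ simplex (m + 1)) (N : ℕ) :
    ∑ s ∈ Finset.range N, γ s * (p.slopeX F' z (p.chain r F' hA hB γ ξ s, ξ s) +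
      inner ℝ (p.Gy r (p.chain r F' hA hB γ ξ s).1 (ξ s))
        (y - (p.chain r F' hA hB γ ξ s).2.1)) ≤
      1 + 1 / 2 * ∑ s ∈ Finset.range N, γ s ^ 2 *
        p.sqNorm r F' (p.chain r F' hA hB γ ξ s, ξ s) := by
  set w := p.chain r F' hA hB γ ξ
  have h1 := A.sum_inner_le p.X_convex p.X_closed hA (x := fun s => (w s).1)
    (ζ := fun s => γ s • p.Gx F' (w s).1 (w s).2.1 (ξ s)) rfl (fun _ => rfl) hz N
  have h2 := B.sum_inner_le simplex_convex simplex_isClosed hB (x := fun s => (w s).2.1)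
    (ζ := fun s => γ s • -p.Gy r (w s).1 (ξ s)) rfl (fun _ => rfl) hy N
  have h3 : ∑ s ∈ Finset.range N, γ s * (p.slopeX F' z (w s, ξ s) +
      inner ℝ (p.Gy r (w s).1 (ξ s)) (y - (w s).2.1)) =
      ∑ s ∈ Finset.range N, inner ℝ (γ s • p.Gx F' (w s).1 (w s).2.1 (ξ s)) ((w s).1 - z) +
      ∑ s ∈ Finset.range N, inner ℝ (γ s • -p.Gy r (w s).1 (ξ s)) ((w s).2.1 - y) := by
    rw [← Finset.sum_add_distrib]
    refine Finset.sum_congr rfl fun s _ => ?_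
    simp only [slopeX, real_inner_smul_left, inner_neg_left, inner_sub_right]
    ring
  have h4 : A.ratio / 2 * ∑ s ∈ Finset.range N,
      dualNorm A.nrm (γ s • p.Gx F' (w s).1 (w s).2.1 (ξ s)) ^ 2 +
      B.ratio / 2 * ∑ s ∈ Finset.range N, dualNorm B.nrm (γ s • -p.Gy r (w s).1 (ξ s)) ^ 2 ≤
      1 / 2 * ∑ s ∈ Finset.range N, γ s ^ 2 * p.sqNorm r F' (w s, ξ s) := by
    rw [Finset.mul_sum, Finset.mul_sum, Finset.mul_sum, ← Finset.sum_add_distrib]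
    refine Finset.sum_le_sum fun s _ => ?_
    have h5 := pow_le_pow_left₀ (dualNorm_nonneg A.nrm_definite _)
      (dualNorm_smul_le A.nrm_definite (hγ s) (p.Gx F' (w s).1 (w s).2.1 (ξ s))) 2
    have h6 := pow_le_pow_left₀ (dualNorm_nonneg B.nrm_definite _)
      (dualNorm_smul_le B.nrm_definite (hγ s) (-p.Gy r (w s).1 (ξ s))) 2
    rw [dualNorm_neg B.nrm_definite] at h6
    have h7 := mul_le_mul_of_nonneg_left h5 (A.ratio_pos hA).le
    have h8 := mul_le_mul_of_nonneg_left h6 (B.ratio_pos hB).le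
    simp only [sqNorm]
    linarith
  rw [h3]
  linarith

variable {p r F'}

/-- The regret of the auxiliary sequence, whose gradients are the noise, with `‖Gy - gy‖² ≤ 2 ‖Gy‖²
+ 2 My²` in the dual norm. The nonnegative `x`-parts of `sqNorm` and `M ^ 2` are added so that only
sums controlled elsewhere appear. -/
theorem aux_regret_le {Mx My Q : ℝ} (hl : p.IsLightTailed F' r A B Mx My Q) (hMy : 0 < My)
    (hγ : ∀ s, 0 ≤ γ s) {y : Vec (m + 1)} (hy : y ∈ simplex (m + 1)) (N : ℕ) :
    ∑ s ∈ Finset.range N, γ s * inner ℝ (p.gy r (p.chain r F' hA hB γ ξ s).1 -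
      p.Gy r (p.chain r F' hA hB γ ξ s).1 (ξ s)) (y - (p.chain r F' hA hB γ ξ s).2.2) ≤
      1 / 2 + ∑ s ∈ Finset.range N, γ s ^ 2 * p.sqNorm r F' (p.chain r F' hA hB γ ξ s, ξ s) +
        constM A B Mx My ^ 2 * ∑ s ∈ Finset.range N, γ s ^ 2 := by
  set w := p.chain r F' hA hB γ ξ
  have h2 := B.sum_inner_le simplex_convex simplex_isClosed hB (x := fun s => (w s).2.2)
    (ζ := fun s => γ s • (p.Gy r (w s).1 (ξ s) - p.gy r (w s).1)) rfl (fun _ => rfl) hy N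
  have h3 : ∑ s ∈ Finset.range N, γ s * inner ℝ (p.gy r (w s).1 - p.Gy r (w s).1 (ξ s))
        (y - (w s).2.2) =
      ∑ s ∈ Finset.range N, inner ℝ (γ s • (p.Gy r (w s).1 (ξ s) - p.gy r (w s).1))
        ((w s).2.2 - y) := by
    refine Finset.sum_congr rfl fun s _ => ?_
    simp only [real_inner_smul_left, inner_sub_left, inner_sub_right]
    ring
  have h4 : B.ratio / 2 * ∑ s ∈ Finset.range N,
      dualNorm B.nrm (γ s • (p.Gy r (w s).1 (ξ s) - p.gy r (w s).1)) ^ 2 ≤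
      ∑ s ∈ Finset.range N, γ s ^ 2 * p.sqNorm r F' (w s, ξ s) +
        constM A B Mx My ^ 2 * ∑ s ∈ Finset.range N, γ s ^ 2 := by
    rw [Finset.mul_sum, Finset.mul_sum, ← Finset.sum_add_distrib]
    refine Finset.sum_le_sum fun s _ => ?_
    have h6 := pow_le_pow_left₀ (dualNorm_nonneg B.nrm_definite _)
      (dualNorm_smul_le B.nrm_definite (hγ s) (p.Gy r (w s).1 (ξ s) - p.gy r (w s).1)) 2
    have h7 := sq_dualNorm_sub_le B.nrm_definite (p.Gy r (w s).1 (ξ s)) (p.gy r (w s).1)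
    have h8 := pow_le_pow_left₀ (dualNorm_nonneg B.nrm_definite _)
      (dualNorm_gy_le hl hMy (w s).1.2.1) 2
    have hb := B.ratio_pos hB
    have ha := A.ratio_pos hA
    have h9 : B.ratio / 2 * dualNorm B.nrm (γ s • (p.Gy r (w s).1 (ξ s) - p.gy r (w s).1)) ^ 2 ≤
        B.ratio / 2 * (γ s ^ 2 * (2 * dualNorm B.nrm (p.Gy r (w s).1 (ξ s)) ^ 2 + 2 * My ^ 2)) := by
      refine mul_le_mul_of_nonneg_left (h6.trans ?_) (by positivity)
      rw [mul_pow]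
      exact mul_le_mul_of_nonneg_left (by linarith) (sq_nonneg _)
    have h10 : 0 ≤ γ s ^ 2 * (A.ratio * dualNorm A.nrm (p.Gx F' (w s).1 (w s).2.1 (ξ s)) ^ 2) := by
      positivity
    have h11 : 0 ≤ γ s ^ 2 * (A.ratio * Mx ^ 2) := by positivity
    rw [constM_sq]
    simp only [sqNorm]
    linarith
  rw [h3]
  linarith

end Regret

end SOEC

end LevelSet

namespace LevelSet

namespace SOEC

universe u

variable {d m : ℕ} {Ξ : Fin (m + 1) → Type u} [∀ i, MeasurableSpace (Ξ i)]
  {p : SOEC d m Ξ} {r : ℝ} {F' : ∀ i, Vec d → Ξ i → Vec d}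
  {A : DistGen p.X} {B : DistGen (simplex (m + 1))} (hA : 0 < A.diam) (hB : 0 < B.diam)

/-! ### Error bounds outside the bad events. -/

section Deterministic

variable {γ : ℕ → ℝ} (ξ : ℕ → ∀ i, Ξ i)

include hA hB in
theorem iterate_fst_mem (γ : ℕ → ℝ) (s : ℕ) : (p.iterate F' r A B γ ξ s).1 ∈ p.X := by
  rw [iterate_eq p r F' hA hB]
  exact (p.chain r F' hA hB γ ξ s).1.2.1

include hA hB in
theorem xbar_mem (hγ : ∀ s, 0 < γ s) (t : ℕ) : p.xbar F' r A B γ ξ t ∈ p.X :=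
  p.X_convex.centerMass_mem (t := Finset.range (t + 1)) (w := γ) (fun s _ => (hγ s).le)
    (Finset.sum_pos (fun s _ => hγ s) (by simp)) fun s _ => iterate_fst_mem hA hB ξ γ s

theorem f_xbar_le (hγ : ∀ s, 0 < γ s) (t : ℕ) (i : Fin (m + 1)) :
    (∑ s ∈ Finset.range (t + 1), γ s) * (p.f i (p.xbar F' r A B γ ξ t) - p.lvl r i) ≤
      ∑ s ∈ Finset.range (t + 1), γ s *
        inner ℝ (p.gy r (p.chain r F' hA hB γ ξ s).1) (EuclideanSpace.single i (1 : ℝ)) := by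
  have hΓ : 0 < ∑ s ∈ Finset.range (t + 1), γ s := Finset.sum_pos (fun s _ => hγ s) (by simp)
  have h := (p.f_convexOn i).map_centerMass_le (t := Finset.range (t + 1)) (w := γ)
    (p := fun s => (p.iterate F' r A B γ ξ s).1) (fun s _ => (hγ s).le) hΓ
    fun s _ => iterate_fst_mem hA hB ξ γ s
  change p.f i (p.xbar F' r A B γ ξ t) ≤ _ at h
  simp only [Finset.centerMass, smul_eq_mul, Function.comp] at h
  simp_rw [iterate_eq p r F' hA hB] at h
  rw [le_inv_mul_iff₀ hΓ] at h
  simp_rw [inner_gy_single, mul_sub, Finset.sum_sub_distrib, ← Finset.sum_mul]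
  linarith

variable {Mx My Q : ℝ} (hl : p.IsLightTailed F' r A B Mx My Q) (hMy : 0 < My)
  (hF' : p.IsSubgradientSelection F')

include hMy hl hF'

/-- In the budget `hε`, `3 / 2` is `1 + 1 / 2` and `3 / 2 * R` is `R / 2 + R`, from the main and the
auxiliary regret; `2 * t₁` pays for the martingales of `slopeX` and `slopeY`, and `t₂` for `noise`.
Each of the three inequalities uses only some of these terms. -/
theorem output_le (hγ : ∀ s, 0 < γ s) (t : ℕ) {z : Vec d} (hz : z ∈ p.X) {η R t₁ t₂ : ℝ}
    (hη : 0 ≤ η) (hzη : p.P r z ≤ p.H r + η) (hR0 : 0 ≤ R) (ht₁ : 0 ≤ t₁)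
    (hR : ∑ s ∈ Finset.range (t + 1), γ s ^ 2 *
      p.sqNorm r F' (p.chain r F' hA hB γ ξ s, ξ s) ≤ R)
    (hX : ∑ s ∈ Finset.range (t + 1), γ s *
      (∫ e, p.slopeX F' z (p.chain r F' hA hB γ ξ s, e) ∂p.law -
        p.slopeX F' z (p.chain r F' hA hB γ ξ s, ξ s)) ≤ t₁)
    (hY : ∑ s ∈ Finset.range (t + 1), γ s *
      (∫ e, p.slopeY r (p.chain r F' hA hB γ ξ s, e) ∂p.law -
        p.slopeY r (p.chain r F' hA hB γ ξ s, ξ s)) ≤ t₁)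
    (hN : |∑ s ∈ Finset.range (t + 1), γ s * p.noise r (p.chain r F' hA hB γ ξ s, ξ s)| ≤ t₂)
    {ε : ℝ} (hε : (3 / 2 + 3 / 2 * R + constM A B Mx My ^ 2 *
      ∑ s ∈ Finset.range (t + 1), γ s ^ 2 + 2 * t₁ + t₂) ≤
        (∑ s ∈ Finset.range (t + 1), γ s) * (ε - η)) :
    p.P r (p.xbar F' r A B γ ξ t) - p.H r ≤ ε ∧ |p.uhat F' r A B γ ξ t - p.H r| ≤ ε := by
  have hΓ : 0 < ∑ s ∈ Finset.range (t + 1), γ s := Finset.sum_pos (fun s _ => hγ s) (by simp)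
  set Γ := ∑ s ∈ Finset.range (t + 1), γ s with hΓdef
  set w := p.chain r F' hA hB γ ξ with hw
  have hG : 0 ≤ constM A B Mx My ^ 2 * ∑ s ∈ Finset.range (t + 1), γ s ^ 2 := by positivity
  have hN' := abs_le.1 hN
  have ht₂ : 0 ≤ t₂ := (abs_nonneg _).trans hN
  have hwX : ∀ s, ((w s).1 : Vec d) ∈ p.X := fun s => (w s).1.2.1
  have hreg := fun y hy => p.regret_le r F' hA hB γ ξ (fun s => (hγ s).le) hz (y := y) hy (t + 1)
  have haux := fun y hy =>
    aux_regret_le hA hB γ ξ hl hMy (fun s => (hγ s).le) (y := y) hy (t + 1)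
  simp only [← hw] at hreg haux
  have hvalue : ∑ s ∈ Finset.range (t + 1), γ s *
      (p.phi r (w s).1 (w s).2.1 - ∫ e, p.slopeX F' z (w s, e) ∂p.law) ≤ Γ * (p.H r + η) := by
    rw [hΓdef, Finset.sum_mul]
    refine Finset.sum_le_sum fun s _ => mul_le_mul_of_nonneg_left ?_ (hγ s).le
    have h1 := p.phi_sub_le r hF' (hwX s) hz (w s).2.1.2.1
    have h2 := p.phi_le_P r hz (w s).2.1.2.1
    simp only [slopeX]
    linarith
  have hintY : ∀ s, ∫ e, p.slopeY r (w s, e) ∂p.law =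
      inner ℝ (p.gy r (w s).1) (((w s).2.2 : Vec (m + 1)) - (w s).2.1) := fun s => by
    simp only [slopeY]
    exact p.integral_inner_Gy r (hwX s) _
  -- In order: auxiliary regret, `y`-martingale, main regret, `x`-martingale, and the value bounded
  -- by `hvalue`.
  have hmean : ∀ y, ∑ s ∈ Finset.range (t + 1), γ s * inner ℝ (p.gy r (w s).1) y =
      ∑ s ∈ Finset.range (t + 1), γ s * inner ℝ (p.gy r (w s).1 - p.Gy r (w s).1 (ξ s))
        (y - (w s).2.2) +
      ∑ s ∈ Finset.range (t + 1), γ s *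
        (∫ e, p.slopeY r (w s, e) ∂p.law - p.slopeY r (w s, ξ s)) +
      ∑ s ∈ Finset.range (t + 1), γ s * (p.slopeX F' z (w s, ξ s) +
        inner ℝ (p.Gy r (w s).1 (ξ s)) (y - (w s).2.1)) +
      ∑ s ∈ Finset.range (t + 1), γ s *
        (∫ e, p.slopeX F' z (w s, e) ∂p.law - p.slopeX F' z (w s, ξ s)) +
      ∑ s ∈ Finset.range (t + 1), γ s *
        (p.phi r (w s).1 (w s).2.1 - ∫ e, p.slopeX F' z (w s, e) ∂p.law) := fun y => by
    simp only [← Finset.sum_add_distrib]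
    refine Finset.sum_congr rfl fun s _ => ?_
    rw [hintY, p.phi_eq r (hwX s)]
    simp only [slopeY, inner_sub_left, inner_sub_right]
    ring
  have hupper : ∀ y, ∑ s ∈ Finset.range (t + 1), γ s * (p.Phi r (w s).1 (w s).2.1 (ξ s) +
        inner ℝ (p.Gy r (w s).1 (ξ s)) (y - (w s).2.1)) =
      ∑ s ∈ Finset.range (t + 1), γ s * p.noise r (w s, ξ s) +
      ∑ s ∈ Finset.range (t + 1), γ s * (p.slopeX F' z (w s, ξ s) +
        inner ℝ (p.Gy r (w s).1 (ξ s)) (y - (w s).2.1)) +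
      ∑ s ∈ Finset.range (t + 1), γ s *
        (∫ e, p.slopeX F' z (w s, e) ∂p.law - p.slopeX F' z (w s, ξ s)) +
      ∑ s ∈ Finset.range (t + 1), γ s *
        (p.phi r (w s).1 (w s).2.1 - ∫ e, p.slopeX F' z (w s, e) ∂p.law) := fun y => by
    simp only [← Finset.sum_add_distrib]
    refine Finset.sum_congr rfl fun s _ => ?_
    simp only [noise]
    ring
  -- Here the true mean is compared directly with the model maximized in `uhat`, so neither the main
  -- regret nor `z` enters.
  have hlower : ∀ y, ∑ s ∈ Finset.range (t + 1), γ s * inner ℝ (p.gy r (w s).1) y =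
      ∑ s ∈ Finset.range (t + 1), γ s * (p.Phi r (w s).1 (w s).2.1 (ξ s) +
        inner ℝ (p.Gy r (w s).1 (ξ s)) (y - (w s).2.1)) +
      ∑ s ∈ Finset.range (t + 1), γ s * inner ℝ (p.gy r (w s).1 - p.Gy r (w s).1 (ξ s))
        (y - (w s).2.2) +
      ∑ s ∈ Finset.range (t + 1), γ s *
        (∫ e, p.slopeY r (w s, e) ∂p.law - p.slopeY r (w s, ξ s)) -
      ∑ s ∈ Finset.range (t + 1), γ s * p.noise r (w s, ξ s) := fun y => by
    rw [← Finset.sum_add_distrib, ← Finset.sum_add_distrib, ← Finset.sum_sub_distrib]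
    refine Finset.sum_congr rfl fun s _ => ?_
    rw [hintY, noise, p.phi_eq r (hwX s)]
    simp only [slopeY, inner_sub_left, inner_sub_right]
    ring
  obtain ⟨i, hi⟩ := p.exists_P_eq r (p.xbar F' r A B γ ξ t)
  have hPf := f_xbar_le (r := r) (F' := F') hA hB ξ hγ t i
  rw [← hi, ← hΓdef, ← hw] at hPf
  have hei := single_mem_simplex i
  have hH := p.H_le r A hF' (xbar_mem (r := r) (F' := F') hA hB ξ hγ t)
  set u : Vec (m + 1) → ℝ := fun y => Γ⁻¹ * ∑ s ∈ Finset.range (t + 1), γ s *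
    (p.Phi r (w s).1 (w s).2.1 (ξ s) + inner ℝ (p.Gy r (w s).1 (ξ s)) (y - (w s).2.1)) with hu
  have huhat : p.uhat F' r A B γ ξ t = sSup (u '' simplex (m + 1)) := by
    unfold uhat
    simp_rw [iterate_eq p r F' hA hB]
    rfl
  have hbdd : BddAbove (u '' simplex (m + 1)) := by
    refine (B.isCompact simplex_convex simplex_isClosed).bddAbove_image ?_
    rw [hu]
    fun_prop
  have hle_uhat : Γ * u (EuclideanSpace.single i 1) ≤ Γ * p.uhat F' r A B γ ξ t := by
    rw [huhat]
    exact mul_le_mul_of_nonneg_left (le_csSup hbdd ⟨_, hei, rfl⟩) hΓ.le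
  have hmul : ∀ y, Γ * u y = ∑ s ∈ Finset.range (t + 1), γ s *
      (p.Phi r (w s).1 (w s).2.1 (ξ s) + inner ℝ (p.Gy r (w s).1 (ξ s)) (y - (w s).2.1)) :=
    fun y => by rw [hu]; simp only; rw [mul_inv_cancel_left₀ hΓ.ne']
  refine ⟨?_, abs_le.2 ⟨?_, ?_⟩⟩
  · refine le_of_mul_le_mul_left ?_ hΓ
    rw [hmean] at hPf
    have h1 := hreg _ hei
    have h2 := haux _ hei
    linarith
  · refine le_of_mul_le_mul_left ?_ hΓ
    rw [hlower, ← hmul] at hPf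
    have h2 := haux _ hei
    have h3 := mul_le_mul_of_nonneg_left hH hΓ.le
    have h4 : 0 ≤ Γ * η := by positivity
    linarith
  · rw [sub_le_iff_le_add, huhat]
    refine csSup_le ⟨_, _, hei, rfl⟩ ?_
    rintro _ ⟨y, hy, rfl⟩
    refine le_of_mul_le_mul_left ?_ hΓ
    rw [hmul, hupper]
    have h1 := hreg _ hy
    linarith

end Deterministic

/-- With `q = √(G * L)`, `M * q ≤ 5 / 17 * l * Ω`, so the martingale term `16 * M * q` and `9 / 8 *
l * Ω` from the squared norms stay below `10 * l * Ω`; the terms without `Ω` add up to at most `4 *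
l`. -/
theorem total_error_le {M Q δ ε l G Γ : ℝ} (hM : 0 < M) (hQ : 0 < Q) (hδ : 0 < δ) (hδ1 : δ < 1)
    (hl : 1 ≤ l) (hG : G ≤ l / M ^ 2)
    (h : (Q * constOmega δ + 10 * M * constOmega δ + 4.5 * M) * l ≤ Γ * M * (ε / 2)) :
    3 / 2 + 3 / 2 * ((1 + Real.log (24 / δ)) * (M ^ 2 * G)) + M ^ 2 * G +
      2 * (2 * (2 * (2 * M)) * √(G * Real.log (24 / δ))) + 2 * Q * √(G * Real.log (24 / δ)) ≤
        Γ * (ε - ε / 2) := by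
  have hL := log_div_pos hδ hδ1
  have hΩ := constOmega_pos hδ hδ1
  have hLΩ := log_le_constOmega (δ := δ)
  have hs := mul_sqrt_le hδ hδ1 hM hl hG
  set L := Real.log (24 / δ)
  set Ω := constOmega δ
  set q := √(G * L)
  have hMG : M ^ 2 * G ≤ l := by
    rw [le_div_iff₀ (by positivity)] at hG
    linarith
  have hlΩ : 0 < l * Ω := by positivity
  have h1 : (1 + L) * (M ^ 2 * G) ≤ (1 + 3 / 4 * Ω) * l :=
    (mul_le_mul_of_nonneg_left hMG (by linarith)).trans
      (mul_le_mul_of_nonneg_right (by linarith) (by linarith))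
  have hs' : M * q ≤ 5 / 17 * (l * Ω) := by norm_num at hs ⊢; linarith
  have hQq : M * (Q * q) ≤ 5 / 17 * (Q * (l * Ω)) := by
    have := mul_le_mul_of_nonneg_left hs' hQ.le
    linarith
  have hQlΩ : 0 < Q * (l * Ω) := by positivity
  refine le_of_mul_le_mul_left ?_ hM
  have h2 : M * (3 / 2 + 3 / 2 * ((1 + L) * (M ^ 2 * G)) + M ^ 2 * G +
      2 * (2 * (2 * (2 * M)) * q)) ≤ M * (9 / 2 * l + 10 * (l * Ω)) :=
    mul_le_mul_of_nonneg_left (by linarith) hM.le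
  norm_num at h
  linarith

/-! ### Bad events and the union bound. -/

section Probability

variable {S : Type*} [MeasurableSpace S] {μ : Measure S} [IsProbabilityMeasure μ]
  {ξ : ℕ → S → ∀ i, Ξ i} (hξ : ∀ t, Measurable (ξ t)) (hlaw : ∀ t, μ.map (ξ t) = p.law)
  (hindep : iIndepFun ξ μ)

include hξ hlaw hindep

theorem measure_centered_ge_le (hF' : p.IsSubgradientSelection F') (γ : ℕ → ℝ)
    {U : (A.dom × B.dom × B.dom) × (∀ i, Ξ i) → ℝ} (hU : Measurable U) {σ : ℝ} (hσ : 0 < σ)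
    (hb : ∀ w, ∫⁻ e, ENNReal.ofReal (Real.exp (U (w, e) ^ 2 / σ ^ 2)) ∂p.law ≤
      ENNReal.ofReal (Real.exp 1)) {N : ℕ} {L : ℝ} (hL : 0 ≤ L)
    (hγ : 0 < ∑ s ∈ Finset.range N, γ s ^ 2) :
    μ {ω | 2 * (2 * σ) * √((∑ s ∈ Finset.range N, γ s ^ 2) * L) ≤
      ∑ s ∈ Finset.range N, γ s *
        (∫ e, U (p.chain r F' hA hB γ (fun k => ξ k ω) s, e) ∂p.law -
          U (p.chain r F' hA hB γ (fun k => ξ k ω) s, ξ s ω))} ≤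
      ENNReal.ofReal (Real.exp (-L)) := by
  have hm : Measurable fun q : (A.dom × B.dom × B.dom) × (∀ i, Ξ i) =>
      ∫ e, U (q.1, e) ∂p.law - U q :=
    ((hU.stronglyMeasurable.integral_prod_right' (ν := p.law)).measurable.comp
      measurable_fst).sub hU
  exact measure_sum_ge_le hξ hindep hlaw
    (W := fun n ω => p.chain r F' hA hB γ (fun k => ξ k ω) n)
    (p.measurable_chain r hA hB hF' γ ξ) hm (by positivity)
    (fun w θ => lintegral_exp_mul_centered_le
      (hU.comp (measurable_const.prodMk measurable_id : Measurable fun e => (w, e))) hσ (hb w) θ)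
    γ hL hγ

theorem isStochasticOracle_of_le (hA : 0 < A.diam) (hB : 0 < B.diam)
    (hF' : p.IsSubgradientSelection F') {Mx My Q : ℝ} (hMx : 0 < Mx) (hMy : 0 < My) (hQ : 0 < Q)
    (hl : p.IsLightTailed F' r A B Mx My Q) {ε δ : ℝ} (hε : 0 < ε) (hδ : 0 < δ) (hδ1 : δ < 1)
    {K : ℝ} (hK : K = Q * constOmega δ + 10 * constM A B Mx My * constOmega δ +
      4.5 * constM A B Mx My) {t : ℕ} (ht : 6 ≤ t + 1)
    (hT : (16 * K / ε * Real.log (8 * K / ε)) ^ 2 ≤ ((t + 1 : ℕ) : ℝ) + 3) :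
    p.IsStochasticOracle μ r ε δ
      (fun s => p.uhat F' r A B (stepLength (constM A B Mx My)) (fun n => ξ n s) t)
      (fun s => p.xbar F' r A B (stepLength (constM A B Mx My)) (fun n => ξ n s) t) := by
  have hM := constM_pos (B := B) (My := My) hA hMx
  set M := constM A B Mx My with hMdef
  set γ := stepLength M with hγdef
  have hγ : ∀ s, 0 < γ s := stepLength_pos hM
  have hΩ := constOmega_pos hδ hδ1
  have hL := log_div_pos hδ hδ1
  refine ⟨fun s => xbar_mem hA hB _ hγ t, ?_⟩
  obtain ⟨z, hz, hzP⟩ := p.exists_P_le r (half_pos hε)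
  set G := ∑ s ∈ Finset.range (t + 1), γ s ^ 2 with hGdef
  have hG0 : 0 < G := Finset.sum_pos (fun s _ => pow_pos (hγ s) 2) (by simp)
  set L := Real.log (24 / δ) with hLdef
  have hexp : Real.exp (-L) = δ / 24 := by
    rw [Real.exp_neg, Real.exp_log (by positivity), inv_div]
  let W := fun n ω => p.chain r F' hA hB γ (fun k => ξ k ω) n
  have hW := p.measurable_chain r hA hB hF' γ ξ
  have hb1 := measure_weighted_sum_ge_le hξ hindep hlaw (W := W) hW
    ((p.measurable_sqNorm r hF').div_const (M ^ 2))
    (lintegral_exp_sqNorm_le hA hl hMx hMy hF') (fun s => sq_nonneg (γ s)) hG0 L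
  have hb2 := measure_centered_ge_le (r := r) hA hB hξ hlaw hindep hF' γ
    (p.measurable_slopeX hF' z) (by positivity : 0 < 2 * M)
    (lintegral_exp_sq_slopeX_le hA hl hMx hz) hL.le hG0
  have hb3 := measure_centered_ge_le (r := r) hA hB hξ hlaw hindep hF' γ
    (p.measurable_slopeY r) (by positivity : 0 < 2 * M)
    (lintegral_exp_sq_slopeY_le hA hl hMx hMy) hL.le hG0
  have hb4 := measure_sum_ge_le hξ hindep hlaw (W := W) hW (p.measurable_noise r) hQ
    (lintegral_exp_noise_le hl hQ) γ hL.le hG0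
  have hb5 := measure_sum_ge_le hξ hindep hlaw (W := W) hW (p.measurable_noise r).neg hQ
    (fun w θ => by simpa using lintegral_exp_noise_le hl hQ w (-θ)) γ hL.le hG0
  rw [hexp] at hb1 hb2 hb3 hb4 hb5
  set b1 := {ω | (1 + L) * ∑ s ∈ Finset.range (t + 1), γ s ^ 2 ≤
    ∑ s ∈ Finset.range (t + 1), γ s ^ 2 * (p.sqNorm r F' (W s ω, ξ s ω) / M ^ 2)}
  set b2 := {ω | 2 * (2 * (2 * M)) * √(G * L) ≤ ∑ s ∈ Finset.range (t + 1), γ s *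
    (∫ e, p.slopeX F' z (W s ω, e) ∂p.law - p.slopeX F' z (W s ω, ξ s ω))}
  set b3 := {ω | 2 * (2 * (2 * M)) * √(G * L) ≤ ∑ s ∈ Finset.range (t + 1), γ s *
    (∫ e, p.slopeY r (W s ω, e) ∂p.law - p.slopeY r (W s ω, ξ s ω))}
  set b4 := {ω | 2 * Q * √(G * L) ≤ ∑ s ∈ Finset.range (t + 1), γ s * p.noise r (W s ω, ξ s ω)}
  set b5 := {ω | 2 * Q * √(G * L) ≤
    ∑ s ∈ Finset.range (t + 1), γ s * (-p.noise r) (W s ω, ξ s ω)}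
  set good := {s | p.P r (p.xbar F' r A B γ (fun n => ξ n s) t) - p.H r ≤ ε ∧
    |p.uhat F' r A B γ (fun n => ξ n s) t - p.H r| ≤ ε}
  -- Covering the whole space and using subadditivity avoids any measurability claim about `good`.
  have hcover : Set.univ ⊆ good ∪ (b1 ∪ (b2 ∪ (b3 ∪ (b4 ∪ b5)))) := by
    intro ω _
    by_contra hω
    simp only [Set.mem_union, not_or] at hω
    obtain ⟨hg, h1, h2, h3, h4, h5⟩ := hω
    simp only [b1, b2, b3, b4, b5, Set.mem_ofPred_eq, not_le] at h1 h2 h3 h4 h5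
    refine hg (output_le hA hB _ hl hMy hF' hγ t hz (half_pos hε).le hzP
      (R := (1 + L) * (M ^ 2 * G)) (t₁ := 2 * (2 * (2 * M)) * √(G * L))
      (t₂ := 2 * Q * √(G * L)) (by positivity) (by positivity) ?_ h2.le h3.le ?_ ?_)
    · simp_rw [← mul_div_assoc, ← Finset.sum_div] at h1
      rw [div_lt_iff₀ (by positivity)] at h1
      refine h1.le.trans_eq ?_
      rw [← hGdef]
      ring
    · simp only [Pi.neg_apply, mul_neg, Finset.sum_neg_distrib] at h5
      exact abs_le.2 ⟨by linarith, h4.le⟩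
    · refine total_error_le (l := 1 + Real.log ((t + 1 : ℕ) : ℝ)) hM hQ hδ hδ1 ?_
        (sum_sq_stepLength_le M (t + 1)) ?_
      · linarith [Real.log_natCast_nonneg (t + 1)]
      · have hKpos : 0 < K := by rw [hK]; positivity
        have hrate := rate_le hKpos hε ht hT
        rw [← hK]
        refine hrate.trans ?_
        have hΓ := le_sum_stepLength hM (t + 1)
        rw [div_le_iff₀ hM] at hΓ
        rw [mul_comm (ε / 2)]
        exact mul_le_mul_of_nonneg_right hΓ (half_pos hε).le
  have hmeas : (1 : ENNReal) ≤ μ good + ENNReal.ofReal δ := by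
    calc (1 : ENNReal) = μ Set.univ := measure_univ.symm
      _ ≤ μ (good ∪ (b1 ∪ (b2 ∪ (b3 ∪ (b4 ∪ b5))))) := measure_mono hcover
      _ ≤ μ good + (μ b1 + (μ b2 + (μ b3 + (μ b4 + μ b5)))) := by
          refine (measure_union_le _ _).trans (add_le_add le_rfl ?_)
          refine (measure_union_le _ _).trans (add_le_add le_rfl ?_)
          refine (measure_union_le _ _).trans (add_le_add le_rfl ?_)
          refine (measure_union_le _ _).trans (add_le_add le_rfl ?_)
          exact measure_union_le _ _
      _ ≤ μ good + (ENNReal.ofReal (δ / 24) + (ENNReal.ofReal (δ / 24) +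
          (ENNReal.ofReal (δ / 24) + (ENNReal.ofReal (δ / 24) + ENNReal.ofReal (δ / 24))))) := by
          gcongr
      _ ≤ μ good + ENNReal.ofReal δ := by
          have h0 : 0 ≤ δ / 24 := by positivity
          rw [← ENNReal.ofReal_add h0 h0, ← ENNReal.ofReal_add h0 (by positivity),
            ← ENNReal.ofReal_add h0 (by positivity), ← ENNReal.ofReal_add h0 (by positivity)]
          gcongr
          linarith
  rw [ENNReal.ofReal_sub _ hδ.le, ENNReal.ofReal_one]
  exact tsub_le_iff_right.2 hmeas

end Probability

end SOEC

end LevelSet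

theorem theorem2 {d m : ℕ} (hm : 1 ≤ m)
    {Ξ : Fin (m + 1) → Type*} [∀ i, MeasurableSpace (Ξ i)]
    (p : LevelSet.SOEC d m Ξ) (hp : p.StrictlyFeasible)
    (A : LevelSet.DistGen p.X) (B : LevelSet.DistGen (LevelSet.simplex (m + 1)))
    (F' : ∀ i, LevelSet.Vec d → Ξ i → LevelSet.Vec d) (hF' : p.IsSubgradientSelection F')
    (r : ℝ) (hr : p.fstar < r)
    (Mx My Q : ℝ) (hMx : 0 < Mx) (hMy : 0 < My) (hQ : 0 < Q)
    (hlight : p.IsLightTailed F' r A B Mx My Q)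
    (ε δ : ℝ) (hε : 0 < ε) (hδ : 0 < δ) (hδ1 : δ < 1)
    {S : Type*} [MeasurableSpace S] (μ : MeasureTheory.Measure S)
    [MeasureTheory.IsProbabilityMeasure μ]
    (ξ : ℕ → S → ∀ i, Ξ i) (hξ : ∀ t, Measurable (ξ t))
    (hlaw : ∀ t, μ.map (ξ t) = p.law) (hindep : ProbabilityTheory.iIndepFun ξ μ) :
    let M := LevelSet.constM A B Mx My
    let γ := LevelSet.stepLength M
    let T := LevelSet.iterBound M Q δ ε
    let Oracle (t : ℕ) : Prop :=
      p.IsStochasticOracle μ r ε δ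
        (fun s => p.uhat F' r A B γ (fun n => ξ n s) t)
        (fun s => p.xbar F' r A B γ (fun n => ξ n s) t)
    (∃ t : ℕ, (t : ℝ) + 1 ≤ T ∧ Oracle t) ∧ ∀ t : ℕ, T ≤ t → Oracle t := by
  intro M γ T Oracle
  have hA := A.diam_pos p.X_convex (LevelSet.SOEC.X_nontrivial hp)
  have hB := B.diam_pos LevelSet.simplex_convex (LevelSet.simplex_nontrivial hm)
  -- With `N = t + 1` iterations, the squared term of `iterBound` is at most `T + 2 ≤ t + 4 = N +
  -- 3`. This slack admits `⌊T⌋₊ - 1`, for which only `T < t + 2` is known.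
  have horacle : ∀ t : ℕ, 6 ≤ t + 1 → T ≤ (t : ℝ) + 2 → Oracle t := fun t ht hT => by
    refine LevelSet.SOEC.isStochasticOracle_of_le hξ hlaw hindep hA hB hF' hMx hMy hQ hlight
      hε hδ hδ1 rfl ht ?_
    have h := (le_max_right _ _).trans hT
    push_cast
    linarith
  -- Iterations are numbered from `0`, so this index means exactly `⌊T⌋₊` of them.
  refine ⟨⟨⌊T⌋₊ - 1, ?_, ?_⟩, fun t ht => ?_⟩
  · have h6 : 6 ≤ ⌊T⌋₊ := Nat.le_floor (by exact_mod_cast le_max_left _ _)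
    have hfl := Nat.floor_le (show 0 ≤ T from le_trans (by norm_num) (le_max_left (6 : ℝ) _))
    rw [Nat.cast_sub (by omega)]
    push_cast
    linarith
  · have h6 : 6 ≤ ⌊T⌋₊ := Nat.le_floor (by exact_mod_cast le_max_left _ _)
    have hfl := Nat.lt_floor_add_one T
    refine horacle _ (by omega) ?_
    rw [Nat.cast_sub (by omega)]
    push_cast
    linarith
  · have h6 : (6 : ℝ) ≤ t := (le_max_left _ _).trans ht
    have h6' : 6 ≤ t := by exact_mod_cast h6
    exact horacle t (by omega) (by linarith)
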